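/- **Setting.** For a function $t$ on $\mathbb R$ write $t^*(\omega)=\int_{\mathbb R} e^{i\omega x}t(x)\,dx$. One observes $Y_j=\theta_j+\xi_j$, $j=1,\dots,n$, where all the $\theta_j$ and $\xi_j$ are independent, the $\theta_j$ have an unknown probability density $f$ and the $\xi_j$ have a known probability density $g$. For $s\ge 0$ and $B>0$ let $\Omega_s(B)$ be the set of probability densities $f$ with $\int |f^*(\omega)|^2(\omega^2+1)^s\,d\omega\le B^2$. The target is a (possibly complex valued) linear functional $\Phi$ which, for a measurable function $\varphi^*:\mathbb R\to\mathbb C$, is represented on $\Omega_s(B)$ by an absolutely convergent integral $$\Phi=\Phi(f)=\frac1{2\pi}\int f^*(\omega)\,\varphi^*(-\omega)\,d\omega ,\qquad f\in\Omega_s(B)$$ (for example $\Phi(f)=\int\varphi f$, with $\varphi^*$ the Fourier transform of $\varphi$, or $\Phi(f)=f(x_0)$, with $\varphi^*(\omega)=e^{i\omega x_0}$, whenever this representation holds). For $h\ge0$ the cut-off estimator is $$\widehat\Phi_h=\frac1{2\pi}\int\frac{\widehat{q}^*(\omega)}{g^*(\omega)}\,\varphi^*(-\omega)\,\mathbb I(h|\omega|\le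 1)\,d\omega,\qquad \widehat{q}^*(\omega)=\frac1n\sum_{j=1}^n e^{i\omega Y_j};$$ if $h=0$ and $\varphi^*(-\omega)/g^*(\omega)$ is square integrable but not integrable, then $\widehat\Phi_0=\frac1n\sum_j\psi(Y_j)$, where $\psi(y)=\frac1{2\pi}\int e^{i\omega y}\varphi^*(-\omega)/g^*(\omega)\,d\omega$ is taken in the $L^2$ (Plancherel) sense. Put $R_n(\widehat\Phi_h,\Omega_s(B))=\sup_{f\in\Omega_s(B)}\mathbb E|\widehat\Phi_h-\Phi(f)|^2$. **Assumptions.** The density $g$ is bounded above, and there are constants $C_g>0$, $C_\varphi\ge0$ and $\alpha,\beta,\gamma,a,b,d\ge0$ such that, for all $\omega\in\mathbb R$, $$|g^*(\omega)|\ge C_g(\omega^2+1)^{-\alpha/2}e^{-\gamma|\omega|^\beta},\qquad |\varphi^*(\omega)|\le C_\varphi(\omega^2+1)^{-a/2}e^{-d|\omega|^b},$$ where $\alpha>0$ and $\beta=0$ if $\gamma=0$, and $b=0$ if $d=0$. **Rates.** For real $A_1,A_2$ put $$h^*(n)=\Big[\tfrac1{2\gamma}\Big(\log n-\tfrac{2A_1+2A_2+1-\beta}{\beta}\log\log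 n\Big)\Big]^{-1/\beta},\qquad V_1=\tfrac{2A_1}{\beta}-\tfrac{d(2A_1+2A_2+1-\beta)}{\beta\gamma},$$ and define $\tilde h_n$ and $\Delta_n=\Delta_n(A_1,A_2,b,d,\beta,\gamma)$ as follows. 1. If $b>\beta$: $\Delta_n=n^{-1}$, $\tilde h_n=0$. 2. If $b=\beta>0$, $d>\gamma>0$: $\Delta_n=n^{-1}$, $\tilde h_n=0$. 3. If $b=\beta$, $d=\gamma$, $A_2<-1/2$: $\Delta_n=n^{-1}$, $\tilde h_n=0$. 4. If $b=\beta>0$, $d=\gamma>0$, $A_2=-1/2$: $\Delta_n=n^{-1}\log\log n$, $\tilde h_n=[\log n/(2\gamma)]^{-1/\beta}$. 5. If $b=\beta>0$, $d=\gamma>0$, $A_2>-1/2$: $\Delta_n=n^{-1}(\log n)^{(2A_2+1)/b}$, $\tilde h_n=[\log n/(2\gamma)]^{-1/\beta}$. 6. If $b=\beta=d=\gamma=0$, $A_2=-1/2$: $\Delta_n=n^{-1}\log n$, $\tilde h_n=n^{-1/(2A_1)}$. 7. If $b=\beta=d=\gamma=0$, $A_2>-1/2$: $\Delta_n=n^{-2A_1/(2A_1+2A_2+1)}$,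 $\tilde h_n=n^{-1/(2A_1+2A_2+1)}$. 8. If $b=\beta>0$, $\gamma>d>0$: $\Delta_n=(\log n)^{-V_1}n^{-d/\gamma}$, $\tilde h_n=h^*(n)$. 9. If $\beta>b>0$, $d>0$, $\gamma>0$: $\Delta_n=(\log n)^{-2A_1/\beta}\exp(-2d[h^*(n)]^{-b})$, $\tilde h_n=h^*(n)$. 10. If $b=d=0$, $\beta>0$, $\gamma>0$: $\Delta_n=(\log n)^{-2A_1/\beta}$, $\tilde h_n=h^*(n)$. **Theorem.** Take $A_1=s+a+(b-1)/2$ and $A_2=\alpha-a$. In each of the ten cases there is a constant $C>0$, independent of $n$, such that for all sufficiently large $n$ $$R_n(\widehat\Phi_{\tilde h_n},\Omega_s(B))\le C\,\Delta_n\big(s+a+(b-1)/2,\ \alpha-a,\ b,d,\beta,\gamma\big).$$ -/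

import Mathlib

open MeasureTheory Filter Topology
open scoped ENNReal FourierTransform

noncomputable section

namespace Deconv

/-- The Fourier transform `t*(ω) = ∫ exp(i ω x) t(x) dx`. -/
def ft (t : ℝ → ℝ) (ω : ℝ) : ℂ :=
  ∫ x : ℝ, Complex.exp (Complex.I * (ω * x : ℝ)) * (t x : ℂ)

/-- `f` is a probability density function on the line. -/
structure IsPdf (f : ℝ → ℝ) : Prop where
  measurable : Measurable f
  nonneg : ∀ x, 0 ≤ f x
  lintegral_eq_one : ∫⁻ x : ℝ, ENNReal.ofReal (f x) = 1

/-- The probability distribution with density `f`. -/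
def law (f : ℝ → ℝ) : Measure ℝ :=
  volume.withDensity fun x => ENNReal.ofReal (f x)

/-- The class `Ω_s(B)`: the probability densities `f` with
`∫ |f*(ω)|² (ω² + 1)^s dω ≤ B²`. -/
def sobolevBall (s B : ℝ) : Set (ℝ → ℝ) :=
  {f | IsPdf f ∧
    ∫⁻ ω : ℝ, ENNReal.ofReal (‖ft f ω‖ ^ 2 * (ω ^ 2 + 1) ^ s) ≤ ENNReal.ofReal (B ^ 2)}

/-- The distribution of `(Y_1, …, Y_n)` where `Y_j = θ_j + ξ_j` and all the `θ_j ∼ f`, `ξ_j ∼ g`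
are independent. -/
def sampleLaw (f g : ℝ → ℝ) (n : ℕ) : Measure (Fin n → ℝ) :=
  Measure.pi fun _ : Fin n => ((law f).prod (law g)).map fun p : ℝ × ℝ => p.1 + p.2

/-- The functional `Φ` is represented on the class `F` by an absolutely convergent integral
`Φ(f) = (1 / 2π) ∫ f*(ω) φ*(-ω) dω`. The function `φs` stands for `φ*`. -/
def IsRepresentedOn (F : Set (ℝ → ℝ)) (Φ : (ℝ → ℝ) → ℂ) (φs : ℝ → ℂ) : Prop :=
  ∀ f ∈ F, Integrable (fun ω : ℝ => ft f ω * φs (-ω)) ∧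
    Φ f = (2 * Real.pi : ℂ)⁻¹ * ∫ ω : ℝ, ft f ω * φs (-ω)

/-- The empirical characteristic function `n⁻¹ ∑ exp(i ω Y_j)`. -/
def empFt {n : ℕ} (Y : Fin n → ℝ) (ω : ℝ) : ℂ :=
  (n : ℂ)⁻¹ * ∑ j, Complex.exp (Complex.I * (ω * Y j : ℝ))

/-- The function `ω ↦ (φ*(-ω) / g*(ω)) 𝟙(|ω| ≤ 1/h)`. The condition `|ω| ≤ 1/h` is written
`h |ω| ≤ 1`, so that `h = 0` means that there is no cut-off. -/
def cutoffRatio (g : ℝ → ℝ) (φs : ℝ → ℂ) (h ω : ℝ) : ℂ :=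
  open Classical in if h * |ω| ≤ 1 then φs (-ω) / ft g ω else 0

/-- The function `y ↦ (1 / 2π) ∫ exp(i ω y) r(ω) dω` of a square integrable `r`, in the sense of
Plancherel. As `(1 / 2π) ∫ exp(i ω y) r(ω) dω = ∫ exp(2 π i x y) r(2 π x) dx`, this is Mathlib's
inverse Fourier transform of `x ↦ r(2 π x)`. -/
def plancherelKernel (r : ℝ → ℂ) : ℝ → ℂ :=
  open Classical in
  if hr : MemLp (fun x : ℝ => r (2 * Real.pi * x)) 2 (volume : Measure ℝ) then
    ((𝓕⁻ (hr.toLp (fun x : ℝ => r (2 * Real.pi * x))) : Lp ℂ 2 (volume : Measure ℝ)) : ℝ → ℂ)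
  else 0

/-- The cut-off estimator
`(1 / 2π) ∫ (q̂*(ω) / g*(ω)) φ*(-ω) 𝟙(|ω| ≤ 1/h) dω`, with `q̂*` the empirical characteristic
function. The integral is an ordinary one if `(φ*(-·) / g*) 𝟙(|·| ≤ 1/h)` is integrable, as it
always is for `h > 0` when `φ*` and `1/g*` are locally bounded. If that function is only square
integrable (this can occur for `h = 0`), the integral
`n⁻¹ ∑ (1 / 2π) ∫ exp(i ω Y_j) (φ*(-ω) / g*(ω)) dω` is understood in the sense of Plancherel;
it is then defined almost surely, because `Y_j` has a density. -/
def estimator (g : ℝ → ℝ) (φs : ℝ → ℂ) (h : ℝ) {n : ℕ} (Y : Fin n → ℝ) : ℂ :=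
  open Classical in
  if Integrable (cutoffRatio g φs h) then
    (2 * Real.pi : ℂ)⁻¹ * ∫ ω : ℝ, empFt Y ω * cutoffRatio g φs h ω
  else (n : ℂ)⁻¹ * ∑ j, plancherelKernel (cutoffRatio g φs h) (Y j)

/-- The worst-case mean squared error `sup_{f ∈ F} E |Φ̂_h - Φ(f)|²`. -/
def worstRisk (F : Set (ℝ → ℝ)) (g : ℝ → ℝ) (Φ : (ℝ → ℝ) → ℂ) (φs : ℝ → ℂ) (n : ℕ) (h : ℝ) :
    ℝ≥0∞ :=
  ⨆ f ∈ F, ∫⁻ Y, ‖estimator g φs h Y - Φ f‖ₑ ^ 2 ∂(sampleLaw f g n)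

/-- The bandwidth `h*(n)`. -/
def hStar (A₁ A₂ β γ : ℝ) (n : ℕ) : ℝ :=
  (1 / (2 * γ) * (Real.log n - (2 * A₁ + 2 * A₂ + 1 - β) / β * Real.log (Real.log n))) ^ (-1 / β)

/-- The exponent `V₁`. -/
def V₁ (A₁ A₂ d β γ : ℝ) : ℝ :=
  2 * A₁ / β - d * (2 * A₁ + 2 * A₂ + 1 - β) / (β * γ)

/-- The table of rates: `RateTable A₁ A₂ b d β γ h Δ` says that the parameters
`A₁, A₂, b, d, β, γ` belong to one of the ten regimes, and that `n ↦ h n` is the bandwidth and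
`n ↦ Δ n` the rate of that regime. -/
inductive RateTable (A₁ A₂ b d β γ : ℝ) : (ℕ → ℝ) → (ℕ → ℝ) → Prop
  | case1 (hb : b > β) :
      RateTable A₁ A₂ b d β γ (fun _ => 0) (fun n => (n : ℝ)⁻¹)
  | case2 (hb : b = β) (hβ : β > 0) (hd : d > γ) (hγ : γ > 0) :
      RateTable A₁ A₂ b d β γ (fun _ => 0) (fun n => (n : ℝ)⁻¹)
  | case3 (hb : b = β) (hd : d = γ) (hA : A₂ < -1 / 2) :
      RateTable A₁ A₂ b d β γ (fun _ => 0) (fun n => (n : ℝ)⁻¹)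
  | case4 (hb : b = β) (hβ : β > 0) (hd : d = γ) (hγ : γ > 0) (hA : A₂ = -1 / 2) :
      RateTable A₁ A₂ b d β γ (fun n => (Real.log n / (2 * γ)) ^ (-1 / β))
        (fun n => (n : ℝ)⁻¹ * Real.log (Real.log n))
  | case5 (hb : b = β) (hβ : β > 0) (hd : d = γ) (hγ : γ > 0) (hA : A₂ > -1 / 2) :
      RateTable A₁ A₂ b d β γ (fun n => (Real.log n / (2 * γ)) ^ (-1 / β))
        (fun n => (n : ℝ)⁻¹ * Real.log n ^ ((2 * A₂ + 1) / b))
  | case6 (hb : b = 0) (hβ : β = 0) (hd : d = 0) (hγ : γ = 0) (hA : A₂ = -1 / 2) :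
      RateTable A₁ A₂ b d β γ (fun n => (n : ℝ) ^ (-1 / (2 * A₁)))
        (fun n => (n : ℝ)⁻¹ * Real.log n)
  | case7 (hb : b = 0) (hβ : β = 0) (hd : d = 0) (hγ : γ = 0) (hA : A₂ > -1 / 2) :
      RateTable A₁ A₂ b d β γ (fun n => (n : ℝ) ^ (-1 / (2 * A₁ + 2 * A₂ + 1)))
        (fun n => (n : ℝ) ^ (-(2 * A₁) / (2 * A₁ + 2 * A₂ + 1)))
  | case8 (hb : b = β) (hβ : β > 0) (hd : γ > d) (hd₀ : d > 0) :
      RateTable A₁ A₂ b d β γ (hStar A₁ A₂ β γ)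
        (fun n => Real.log n ^ (-V₁ A₁ A₂ d β γ) * (n : ℝ) ^ (-d / γ))
  | case9 (hβ : β > b) (hb : b > 0) (hd : d > 0) (hγ : γ > 0) :
      RateTable A₁ A₂ b d β γ (hStar A₁ A₂ β γ)
        (fun n => Real.log n ^ (-(2 * A₁) / β) *
          Real.exp (-2 * d * hStar A₁ A₂ β γ n ^ (-b)))
  | case10 (hb : b = 0) (hd : d = 0) (hβ : β > 0) (hγ : γ > 0) :
      RateTable A₁ A₂ b d β γ (hStar A₁ A₂ β γ)
        (fun n => Real.log n ^ (-(2 * A₁) / β))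

end Deconv

end

/-
By independence the mean squared error splits into squared bias and variance. The density of the
observations is bounded by the bound of `g`, so by Plancherel the variance is at most a constant
times `n⁻¹ ∫ |φ*/g*|²` over `h |ω| ≤ 1`. By Cauchy-Schwarz the squared bias on the Sobolev ball is
at most a constant times `∫ |φ*(ω)|² (ω² + 1)^(-s)` over `h |ω| > 1`. Up to constants, both
integrands are of the form `(t² + 1)^p exp(P t^x + Q t^y)`, and comparing derivatives bounds such an
integral up to or beyond `T` by `T^(2p + 1 - x) exp(P T^x + Q T^y)`, which the bandwidths of the
table balance.

Where the bias integral diverges the rate does not tend to zero, and a bounded bias suffices. As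
`Φ` is only assumed to be represented on each density separately, the uniform bound for
`∫ |f* φ*|` over the class comes from Baire's theorem: in `L¹` the class is closed, convex and
bounded, and the integral is a lower semicontinuous subadditive function that is finite on it.
-/

namespace Deconv

section Fourier

open scoped SchwartzMap InnerProductSpace

variable {V : Type*} [NormedAddCommGroup V] [InnerProductSpace ℝ V] [FiniteDimensional ℝ V]
  [MeasurableSpace V] [BorelSpace V]

section NormedSpace

variable {F : Type*} [NormedAddCommGroup F] [NormedSpace ℂ F]

theorem integral_fourier_smul_eq_of_integrable [CompleteSpace F] {u : V → ℂ} {v : V → F}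
    (hu : Integrable u) (hv : Integrable v) :
    ∫ x, 𝓕 u x • v x = ∫ x, u x • 𝓕 v x := by
  simpa only [flip_innerₗ] using! VectorFourier.integral_fourierIntegral_smul_eq_flip
    (L := innerₗ V) Real.continuous_fourierChar continuous_inner hu hv

theorem integral_fourierInv_smul_eq_of_integrable [CompleteSpace F] {u : V → ℂ} {v : V → F}
    (hu : Integrable u) (hv : Integrable v) :
    ∫ x, 𝓕⁻ u x • v x = ∫ x, u x • 𝓕⁻ v x := by
  calc ∫ x, 𝓕⁻ u x • v x
      = ∫ x, 𝓕 u x • v (-x) := by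
        rw [← integral_neg_eq_self]
        simp only [Real.fourierInv_eq_fourier_neg, neg_neg]
    _ = ∫ x, u x • 𝓕⁻ v x := by
        rw [integral_fourier_smul_eq_of_integrable hu hv.comp_neg,
          Real.fourierInv_eq_fourier_comp_neg]

theorem continuous_fourier {u : V → F} (hu : Integrable u) : Continuous (𝓕 u) :=
  VectorFourier.fourierIntegral_continuous Real.continuous_fourierChar continuous_inner hu

theorem continuous_fourierInv {u : V → F} (hu : Integrable u) : Continuous (𝓕⁻ u) := by
  rw [Real.fourierInv_eq_fourier_comp_neg]
  exact continuous_fourier hu.comp_neg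

theorem ae_eq_of_integral_schwartz_smul_eq [CompleteSpace F] {μ : Measure V} {u v : V → F}
    (hu : LocallyIntegrable u μ) (hv : LocallyIntegrable v μ)
    (h : ∀ w : 𝓢(V, ℂ), ∫ x, w x • u x ∂μ = ∫ x, w x • v x ∂μ) :
    u =ᵐ[μ] v := by
  refine ae_eq_of_integral_contDiff_smul_eq hu hv fun w hw hwc => ?_
  have hwc' : HasCompactSupport (Complex.ofRealCLM ∘ w) := hwc.comp_left rfl
  have hw' : ContDiff ℝ (⊤ : ℕ∞) (Complex.ofRealCLM ∘ w) := by fun_prop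
  simpa using h (hwc'.toSchwartzMap hw')

end NormedSpace

variable {F : Type*} [NormedAddCommGroup F] [InnerProductSpace ℂ F]

theorem integral_norm_sq_eq_norm_sq {α : Type*} [MeasurableSpace α] {μ : Measure α}
    (u : Lp F 2 μ) : ∫ x, ‖u x‖ ^ 2 ∂μ = ‖u‖ ^ 2 := by
  have h := L2.inner_def (𝕜 := ℂ) u u
  simp only [inner_self_eq_norm_sq_to_K, Complex.coe_algebraMap, ← Complex.ofReal_pow,
    integral_complex_ofReal] at h
  exact_mod_cast h.symm

variable [CompleteSpace F]

theorem fourier_toLp_ae_eq {u : V → F} (h₁ : Integrable u) (h₂ : MemLp u 2) :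
    (𝓕 (h₂.toLp u) : Lp F 2 (volume : Measure V)) =ᵐ[volume] 𝓕 u := by
  refine ae_eq_of_integral_schwartz_smul_eq ((Lp.memLp _).locallyIntegrable one_le_two)
    (continuous_fourier h₁).locallyIntegrable fun w => ?_
  calc ∫ x, w x • (𝓕 (h₂.toLp u) : Lp F 2 (volume : Measure V)) x
      = ∫ x, 𝓕 w x • h₂.toLp u x := by
        simpa using (congrArg (· w) (Lp.fourier_toTemperedDistribution_eq (h₂.toLp u))).symm
    _ = ∫ x, 𝓕 (w : V → ℂ) x • u x :=
        integral_congr_ae <| h₂.coeFn_toLp.mono fun x hx => by simp [hx, SchwartzMap.fourier_coe]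
    _ = ∫ x, w x • 𝓕 u x := integral_fourier_smul_eq_of_integrable w.integrable h₁

theorem fourierInv_toLp_ae_eq {u : V → F} (h₁ : Integrable u) (h₂ : MemLp u 2) :
    (𝓕⁻ (h₂.toLp u) : Lp F 2 (volume : Measure V)) =ᵐ[volume] 𝓕⁻ u := by
  refine ae_eq_of_integral_schwartz_smul_eq ((Lp.memLp _).locallyIntegrable one_le_two)
    (continuous_fourierInv h₁).locallyIntegrable fun w => ?_
  calc ∫ x, w x • (𝓕⁻ (h₂.toLp u) : Lp F 2 (volume : Measure V)) x
      = ∫ x, 𝓕⁻ w x • h₂.toLp u x := by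
        simpa using (congrArg (· w) (Lp.fourierInv_toTemperedDistribution_eq (h₂.toLp u))).symm
    _ = ∫ x, 𝓕⁻ (w : V → ℂ) x • u x :=
        integral_congr_ae <| h₂.coeFn_toLp.mono fun x hx => by
          simp [hx, SchwartzMap.fourierInv_coe]
    _ = ∫ x, w x • 𝓕⁻ u x := integral_fourierInv_smul_eq_of_integrable w.integrable h₁

theorem integral_inner_fourierInv_toLp {q r : V → F} (hq : Integrable q) (hq₂ : MemLp q 2)
    (hr : MemLp r 2) :
    ∫ x, ⟪q x, (𝓕⁻ (hr.toLp r) : Lp F 2 (volume : Measure V)) x⟫_ℂ = ∫ x, ⟪𝓕 q x, r x⟫_ℂ := by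
  have parseval := Lp.inner_fourier_eq (hq₂.toLp q) (𝓕⁻ (hr.toLp r))
  rw [FourierTransform.fourier_fourierInv_eq, L2.inner_def, L2.inner_def] at parseval
  calc ∫ x, ⟪q x, (𝓕⁻ (hr.toLp r) : Lp F 2 (volume : Measure V)) x⟫_ℂ
      = ∫ x, ⟪hq₂.toLp q x, (𝓕⁻ (hr.toLp r) : Lp F 2 (volume : Measure V)) x⟫_ℂ :=
        integral_congr_ae <| hq₂.coeFn_toLp.mono fun x hx => by simp only [hx]
    _ = ∫ x, ⟪(𝓕 (hq₂.toLp q) : Lp F 2 (volume : Measure V)) x, hr.toLp r x⟫_ℂ := parseval.symm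
    _ = ∫ x, ⟪𝓕 q x, r x⟫_ℂ := by
        refine integral_congr_ae ?_
        filter_upwards [fourier_toLp_ae_eq hq hq₂, hr.coeFn_toLp] with x hqx hrx
        rw [hqx, hrx]

theorem integral_norm_sq_fourierInv_toLp {r : V → F} (hr : MemLp r 2) :
    ∫ x, ‖(𝓕⁻ (hr.toLp r) : Lp F 2 (volume : Measure V)) x‖ ^ 2 = ∫ x, ‖r x‖ ^ 2 :=
  calc ∫ x, ‖(𝓕⁻ (hr.toLp r) : Lp F 2 (volume : Measure V)) x‖ ^ 2
      = ‖hr.toLp r‖ ^ 2 := by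
        rw [integral_norm_sq_eq_norm_sq, ← Lp.norm_fourier_eq,
          FourierTransform.fourier_fourierInv_eq]
    _ = ∫ x, ‖r x‖ ^ 2 := by
        rw [← integral_norm_sq_eq_norm_sq]
        exact integral_congr_ae <| hr.coeFn_toLp.mono fun x hx => by simp only [hx]

end Fourier

section Law

theorem IsPdf.isProbabilityMeasure_law {f : ℝ → ℝ} (hf : IsPdf f) :
    IsProbabilityMeasure (law f) :=
  ⟨by rw [law, withDensity_apply _ .univ, setLIntegral_univ, hf.lintegral_eq_one]⟩

theorem IsPdf.integrable {f : ℝ → ℝ} (hf : IsPdf f) : Integrable f := by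
  refine ⟨hf.measurable.aestronglyMeasurable, ?_⟩
  rw [hasFiniteIntegral_iff_ofReal (.of_forall hf.nonneg), hf.lintegral_eq_one]
  exact ENNReal.one_lt_top

theorem IsPdf.integral_law {E : Type*} [NormedAddCommGroup E] [NormedSpace ℝ E] {f : ℝ → ℝ}
    (hf : IsPdf f) (v : ℝ → E) : ∫ x, v x ∂(law f) = ∫ x, f x • v x := by
  rw [law, integral_withDensity_eq_integral_toReal_smul hf.measurable.ennreal_ofReal
    (.of_forall fun _ => ENNReal.ofReal_lt_top)]
  simp only [ENNReal.toReal_ofReal (hf.nonneg _)]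

theorem IsPdf.charFun_law {f : ℝ → ℝ} (hf : IsPdf f) : charFun (law f) = ft f := by
  ext ω
  rw [charFun_apply_real, hf.integral_law, ft]
  congr 1 with x
  rw [Complex.real_smul, mul_comm]
  push_cast
  ring_nf

theorem IsPdf.continuous_ft {f : ℝ → ℝ} (hf : IsPdf f) : Continuous (ft f) := by
  have := hf.isProbabilityMeasure_law
  rw [← hf.charFun_law]
  exact continuous_charFun

/-- The law of one observation `θ + ξ`, where `θ ∼ f` and `ξ ∼ g` are independent. -/
noncomputable def sumLaw (f g : ℝ → ℝ) : Measure ℝ := law f ∗ law g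

theorem sampleLaw_eq_pi_sumLaw (f g : ℝ → ℝ) (n : ℕ) :
    sampleLaw f g n = Measure.pi fun _ : Fin n => sumLaw f g := rfl

theorem isProbabilityMeasure_sumLaw {f g : ℝ → ℝ} (hf : IsPdf f) (hg : IsPdf g) :
    IsProbabilityMeasure (sumLaw f g) := by
  have := hf.isProbabilityMeasure_law
  have := hg.isProbabilityMeasure_law
  exact Measure.probabilitymeasure_of_probabilitymeasures_conv _ _

theorem charFun_sumLaw {f g : ℝ → ℝ} (hf : IsPdf f) (hg : IsPdf g) (ω : ℝ) :
    charFun (sumLaw f g) ω = ft f ω * ft g ω := by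
  have := hf.isProbabilityMeasure_law
  have := hg.isProbabilityMeasure_law
  rw [sumLaw, charFun_conv, hf.charFun_law, hg.charFun_law]

theorem lconvolution_le_of_le {F G : ℝ → ℝ≥0∞} (hF : Measurable F) (hF₁ : ∫⁻ x, F x = 1)
    {M : ℝ≥0∞} (hG : ∀ x, G x ≤ M) (x : ℝ) : lconvolution F G volume x ≤ M :=
  calc lconvolution F G volume x
      ≤ ∫⁻ y, F y * M := lintegral_mono fun y => mul_le_mul_right (hG _) _
    _ = M := by rw [lintegral_mul_const _ hF, hF₁, one_mul]

theorem exists_isPdf_sumLaw_eq_law {f g : ℝ → ℝ} (hf : IsPdf f) (hg : IsPdf g) {M : ℝ}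
    (hM : ∀ x, g x ≤ M) : ∃ q, IsPdf q ∧ (∀ x, q x ≤ M) ∧ sumLaw f g = law q := by
  set Q := lconvolution (fun x => ENNReal.ofReal (f x)) (fun x => ENNReal.ofReal (g x)) volume
  have hQM (x : ℝ) : Q x ≤ ENNReal.ofReal M :=
    lconvolution_le_of_le hf.measurable.ennreal_ofReal hf.lintegral_eq_one
      (fun y => ENNReal.ofReal_le_ofReal (hM y)) x
  have hQ (x : ℝ) : ENNReal.ofReal (Q x).toReal = Q x :=
    ENNReal.ofReal_toReal ((hQM x).trans_lt ENNReal.ofReal_lt_top).ne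
  have hlaw : sumLaw f g = volume.withDensity Q :=
    conv_withDensity_eq_lconvolution hf.measurable.ennreal_ofReal hg.measurable.ennreal_ofReal
  refine ⟨fun x => (Q x).toReal, ⟨?_, fun x => ENNReal.toReal_nonneg, ?_⟩, fun x => ?_, ?_⟩
  · exact (measurable_lconvolution volume hf.measurable.ennreal_ofReal
      hg.measurable.ennreal_ofReal).ennreal_toReal
  · have := isProbabilityMeasure_sumLaw hf hg
    simpa [hQ, hlaw, withDensity_apply _ MeasurableSet.univ] using
      measure_univ (μ := sumLaw f g)
  · exact ENNReal.toReal_le_of_le_ofReal ((hg.nonneg 0).trans (hM 0)) (hQM x)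
  · simp only [hlaw, law, hQ]

theorem law_le_smul {q : ℝ → ℝ} {M : ℝ} (hM : ∀ x, q x ≤ M) :
    law q ≤ ENNReal.ofReal M • volume := by
  rw [law, ← withDensity_const]
  exact withDensity_mono (.of_forall fun x => ENNReal.ofReal_le_ofReal (hM x))

theorem memLp_law {E : Type*} [NormedAddCommGroup E] {q : ℝ → ℝ} {M : ℝ} (hM : ∀ x, q x ≤ M)
    {p : ℝ≥0∞} {v : ℝ → E} (hv : MemLp v p) : MemLp v p (law q) :=
  hv.of_measure_le_smul ENNReal.ofReal_ne_top (law_le_smul hM)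

end Law

section SampleMean

open ProbabilityTheory

variable {Ω : Type*} [MeasurableSpace Ω] {ν : Measure Ω} [IsProbabilityMeasure ν] {n : ℕ}

theorem memLp_sampleMean {𝕜 : Type*} [NormedRing 𝕜] {p : ℝ≥0∞} {X : Ω → 𝕜} (hX : MemLp X p ν)
    (c : 𝕜) :
    MemLp (fun Y : Fin n → Ω => c * ∑ j, X (Y j)) p (Measure.pi fun _ => ν) :=
  (memLp_finsetSum _ fun j _ => hX.comp_measurePreserving (measurePreserving_eval _ j)).const_mul c

theorem integral_sampleMean (hn : n ≠ 0) {X : Ω → ℝ} (hX : Integrable X ν) :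
    ∫ Y, (n : ℝ)⁻¹ * ∑ j, X (Y j) ∂(Measure.pi fun _ : Fin n => ν) = ∫ y, X y ∂ν := by
  have hXj (j : Fin n) : Integrable (fun Y : Fin n → Ω => X (Y j)) (Measure.pi fun _ => ν) :=
    (measurePreserving_eval _ j).integrable_comp_of_integrable hX
  have hint (j : Fin n) : ∫ Y : Fin n → Ω, X (Y j) ∂(Measure.pi fun _ => ν) = ∫ y, X y ∂ν :=
    integral_comp_eval (μ := fun _ => ν) hX.aestronglyMeasurable
  simp [integral_const_mul, integral_finsetSum _ fun j _ => hXj j, hint, hn]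

theorem variance_sampleMean (hn : n ≠ 0) {X : Ω → ℝ} (hX : MemLp X 2 ν) :
    Var[fun Y : Fin n → Ω => (n : ℝ)⁻¹ * ∑ j, X (Y j); Measure.pi fun _ => ν] =
      (n : ℝ)⁻¹ * Var[X; ν] := by
  have hsum := variance_sum_pi (μ := fun _ : Fin n => ν) (X := fun _ => X) fun _ => hX
  simp only [Finset.sum_fn, Finset.sum_const, Finset.card_univ, Fintype.card_fin,
    nsmul_eq_mul] at hsum
  rw [variance_const_mul, hsum]
  field_simp

theorem integral_sampleMean_sub_sq_le (hn : n ≠ 0) {X : Ω → ℝ} (hX : MemLp X 2 ν) (c : ℝ) :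
    ∫ Y, ((n : ℝ)⁻¹ * ∑ j, X (Y j) - c) ^ 2 ∂(Measure.pi fun _ : Fin n => ν) ≤
      (n : ℝ)⁻¹ * ∫ y, X y ^ 2 ∂ν + (∫ y, X y ∂ν - c) ^ 2 := by
  have hS : MemLp (fun Y : Fin n → Ω => (n : ℝ)⁻¹ * ∑ j, X (Y j)) 2 (Measure.pi fun _ => ν) :=
    memLp_sampleMean hX _
  have hdecomp := variance_eq_sub (hS.sub (memLp_const c))
  have hmean : ∫ Y, ((n : ℝ)⁻¹ * ∑ j, X (Y j) - c) ∂(Measure.pi fun _ : Fin n => ν) =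
      ∫ y, X y ∂ν - c := by
    rw [integral_sub (hS.integrable one_le_two) (integrable_const _),
      integral_sampleMean hn (hX.integrable one_le_two)]
    simp
  have hvar : Var[X; ν] ≤ ∫ y, X y ^ 2 ∂ν := variance_le_expectation_sq hX.1
  have hvar' := mul_le_mul_of_nonneg_left hvar (by positivity : 0 ≤ (n : ℝ)⁻¹)
  simp only [Pi.sub_def, Pi.pow_apply, hmean, variance_sub_const hS.1,
    variance_sampleMean hn hX] at hdecomp
  linarith

theorem lintegral_enorm_sq_eq_ofReal {α E : Type*} [MeasurableSpace α] {μ : Measure α}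
    [NormedAddCommGroup E] {k : α → E} (hk : MemLp k 2 μ) :
    ∫⁻ y, ‖k y‖ₑ ^ 2 ∂μ = ENNReal.ofReal (∫ y, ‖k y‖ ^ 2 ∂μ) := by
  rw [ofReal_integral_eq_lintegral_ofReal hk.norm.integrable_sq (.of_forall fun y => by positivity)]
  simp only [ENNReal.ofReal_pow (norm_nonneg _), ofReal_norm]

theorem integral_norm_sq_eq_re_add_im {α : Type*} [MeasurableSpace α] {μ : Measure α} {k : α → ℂ}
    (hk : MemLp k 2 μ) :
    ∫ y, ‖k y‖ ^ 2 ∂μ = ∫ y, (k y).re ^ 2 ∂μ + ∫ y, (k y).im ^ 2 ∂μ := by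
  have hadd := integral_add hk.re.integrable_sq hk.im.integrable_sq
  simp only [RCLike.re_to_complex, RCLike.im_to_complex] at hadd
  rw [← hadd]
  simp only [Complex.sq_norm, Complex.normSq_apply, ← sq]

theorem lintegral_sampleMean_sub_sq_le (hn : n ≠ 0) {k : Ω → ℂ} (hk : MemLp k 2 ν) (z : ℂ) :
    ∫⁻ Y, ‖(n : ℂ)⁻¹ * ∑ j, k (Y j) - z‖ₑ ^ 2 ∂(Measure.pi fun _ : Fin n => ν) ≤
      ENNReal.ofReal ((n : ℝ)⁻¹ * ∫ y, ‖k y‖ ^ 2 ∂ν + ‖∫ y, k y ∂ν - z‖ ^ 2) := by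
  have hk₁ : Integrable k ν := hk.integrable one_le_two
  have hD : MemLp (fun Y : Fin n → Ω => (n : ℂ)⁻¹ * ∑ j, k (Y j) - z) 2 (Measure.pi fun _ => ν) :=
    (memLp_sampleMean hk _).sub (memLp_const z)
  have hre := integral_sampleMean_sub_sq_le hn hk.re z.re
  have him := integral_sampleMean_sub_sq_le hn hk.im z.im
  have hbias : ‖∫ y, k y ∂ν - z‖ ^ 2 =
      (∫ y, (k y).re ∂ν - z.re) ^ 2 + (∫ y, (k y).im ∂ν - z.im) ^ 2 := by
    have hr : ∫ y, (k y).re ∂ν = (∫ y, k y ∂ν).re := integral_re hk₁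
    have hi : ∫ y, (k y).im ∂ν = (∫ y, k y ∂ν).im := integral_im hk₁
    rw [hr, hi, Complex.sq_norm, Complex.normSq_apply, Complex.sub_re, Complex.sub_im, sq, sq]
  rw [lintegral_enorm_sq_eq_ofReal hD, integral_norm_sq_eq_re_add_im hD,
    integral_norm_sq_eq_re_add_im hk, hbias]
  apply ENNReal.ofReal_le_ofReal
  simp only [RCLike.re_to_complex, RCLike.im_to_complex, ← Complex.ofReal_natCast,
    ← Complex.ofReal_inv, Complex.sub_re, Complex.sub_im, Complex.re_ofReal_mul,
    Complex.im_ofReal_mul, Complex.re_sum, Complex.im_sum] at hre him ⊢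
  linarith

end SampleMean

section PlancherelKernel

theorem memLp_comp_mul_left {E : Type*} [NormedAddCommGroup E] {v : ℝ → E} {p : ℝ≥0∞}
    (hv : MemLp v p) {c : ℝ} (hc : c ≠ 0) : MemLp (fun x => v (c * x)) p := by
  refine MemLp.comp_of_map (f := (c * ·)) ?_ (by fun_prop)
  rw [Real.map_volume_mul_left hc]
  exact hv.smul_measure ENNReal.ofReal_ne_top

theorem integral_comp_two_pi_mul {E : Type*} [NormedAddCommGroup E] [NormedSpace ℝ E]
    (v : ℝ → E) : ∫ x : ℝ, v (2 * Real.pi * x) = (2 * Real.pi)⁻¹ • ∫ ω : ℝ, v ω := by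
  rw [Measure.integral_comp_mul_left, abs_of_pos (by positivity)]

theorem fourierInv_comp_two_pi_mul (r : ℝ → ℂ) (y : ℝ) :
    𝓕⁻ (fun x : ℝ => r (2 * Real.pi * x)) y =
      (2 * Real.pi : ℂ)⁻¹ * ∫ ω : ℝ, Complex.exp (Complex.I * (ω * y : ℝ)) * r ω := by
  have h := integral_comp_two_pi_mul fun ω => Complex.exp (Complex.I * (ω * y : ℝ)) * r ω
  rw [Complex.real_smul, Complex.ofReal_inv, Complex.ofReal_mul, Complex.ofReal_ofNat] at h
  rw [Real.fourierInv_eq', ← h]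
  congr 1 with x
  simp only [smul_eq_mul, RCLike.inner_apply, conj_trivial]
  push_cast
  ring_nf

theorem conj_fourier_ofReal (q : ℝ → ℝ) (x : ℝ) :
    starRingEnd ℂ (𝓕 (fun v : ℝ => (q v : ℂ)) x) = ft q (2 * Real.pi * x) := by
  rw [Real.fourier_real_eq_integral_exp_smul, ← integral_conj, ft]
  congr 1 with v
  rw [smul_eq_mul, map_mul, ← Complex.exp_conj, Complex.conj_ofReal, map_mul, Complex.conj_ofReal,
    Complex.conj_I]
  push_cast
  ring_nf

theorem memLp_comp_two_pi_mul {r : ℝ → ℂ} (hr : MemLp r 2) :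
    MemLp (fun x => r (2 * Real.pi * x)) 2 :=
  memLp_comp_mul_left hr Real.two_pi_pos.ne'

theorem plancherelKernel_eq {r : ℝ → ℂ} (hr : MemLp (fun x : ℝ => r (2 * Real.pi * x)) 2) :
    plancherelKernel r = (𝓕⁻ (hr.toLp fun x => r (2 * Real.pi * x)) : Lp ℂ 2 volume) := by
  rw [plancherelKernel, dif_pos hr]

theorem plancherelKernel_ae_eq {r : ℝ → ℂ} (h₁ : Integrable r) (h₂ : MemLp r 2) :
    plancherelKernel r =ᵐ[volume] fun y =>
      (2 * Real.pi : ℂ)⁻¹ * ∫ ω : ℝ, Complex.exp (Complex.I * (ω * y : ℝ)) * r ω := by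
  rw [plancherelKernel_eq (memLp_comp_two_pi_mul h₂)]
  filter_upwards [fourierInv_toLp_ae_eq (h₁.comp_mul_left' Real.two_pi_pos.ne')
    (memLp_comp_two_pi_mul h₂)] with y hy
  rw [hy, fourierInv_comp_two_pi_mul]

theorem memLp_plancherelKernel {r : ℝ → ℂ} (hr : MemLp r 2) : MemLp (plancherelKernel r) 2 := by
  rw [plancherelKernel_eq (memLp_comp_two_pi_mul hr)]
  exact Lp.memLp _

theorem integral_norm_sq_plancherelKernel {r : ℝ → ℂ} (hr : MemLp r 2) :
    ∫ x, ‖plancherelKernel r x‖ ^ 2 = (2 * Real.pi)⁻¹ * ∫ ω, ‖r ω‖ ^ 2 := by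
  rw [plancherelKernel_eq (memLp_comp_two_pi_mul hr), integral_norm_sq_fourierInv_toLp,
    integral_comp_two_pi_mul fun ω => ‖r ω‖ ^ 2, smul_eq_mul]

theorem integral_norm_sq_law_le {E : Type*} [NormedAddCommGroup E] {q : ℝ → ℝ} {M : ℝ}
    (hM₀ : 0 ≤ M) (hM : ∀ x, q x ≤ M) {k : ℝ → E} (hk : MemLp k 2) :
    ∫ y, ‖k y‖ ^ 2 ∂(law q) ≤ M * ∫ y, ‖k y‖ ^ 2 := by
  have hk' : Integrable (fun y => ‖k y‖ ^ 2) (ENNReal.ofReal M • volume) :=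
    hk.norm.integrable_sq.smul_measure ENNReal.ofReal_ne_top
  refine (integral_mono_measure (law_le_smul hM) (.of_forall fun y => by positivity) hk').trans ?_
  rw [integral_smul_measure, ENNReal.toReal_ofReal hM₀, smul_eq_mul]

theorem IsPdf.memLp_two {q : ℝ → ℝ} (hq : IsPdf q) {M : ℝ} (hM : ∀ x, q x ≤ M) :
    MemLp (fun x => (q x : ℂ)) 2 := by
  refine (memLp_two_iff_integrable_sq_norm hq.integrable.ofReal.1).2 <|
    (hq.integrable.const_mul M).mono' (by have := hq.measurable; fun_prop) (.of_forall fun x => ?_)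
  have := hq.nonneg x
  rw [Complex.norm_real, norm_pow, norm_norm, Real.norm_of_nonneg this, sq]
  exact mul_le_mul_of_nonneg_right (hM x) this

theorem integral_plancherelKernel {q : ℝ → ℝ} (hq : IsPdf q) {M : ℝ} (hM : ∀ x, q x ≤ M)
    {r : ℝ → ℂ} (hr : MemLp r 2) :
    ∫ y, plancherelKernel r y ∂(law q) = (2 * Real.pi : ℂ)⁻¹ * ∫ ω, ft q ω * r ω := by
  have parseval := integral_inner_fourierInv_toLp hq.integrable.ofReal (hq.memLp_two hM)
    (memLp_comp_two_pi_mul hr)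
  rw [← plancherelKernel_eq] at parseval
  simp only [RCLike.inner_apply, conj_fourier_ofReal, Complex.conj_ofReal] at parseval
  calc ∫ y, plancherelKernel r y ∂(law q)
      = ∫ y, plancherelKernel r y * q y := by
        rw [hq.integral_law]
        simp only [Complex.real_smul, mul_comm]
    _ = ∫ x, ft q (2 * Real.pi * x) * r (2 * Real.pi * x) := by
        rw [parseval]
        simp only [mul_comm]
    _ = (2 * Real.pi : ℂ)⁻¹ * ∫ ω, ft q ω * r ω := by
        rw [integral_comp_two_pi_mul fun ω => ft q ω * r ω, Complex.real_smul]
        push_cast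
        rfl

end PlancherelKernel

section BiasVariance

theorem integral_empFt_mul {r : ℝ → ℂ} (hr : Integrable r) {n : ℕ} (Y : Fin n → ℝ) :
    ∫ ω, empFt Y ω * r ω =
      (n : ℂ)⁻¹ * ∑ j, ∫ ω : ℝ, Complex.exp (Complex.I * (ω * Y j : ℝ)) * r ω := by
  have hint (j : Fin n) : Integrable fun ω => Complex.exp (Complex.I * (ω * Y j : ℝ)) * r ω := by
    refine hr.bdd_mul (c := 1) (by fun_prop) (.of_forall fun ω => ?_)
    rw [mul_comm Complex.I, Complex.norm_exp_ofReal_mul_I]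
  simp only [empFt, mul_assoc, Finset.sum_mul]
  rw [integral_const_mul, integral_finsetSum _ fun j _ => hint j]

theorem estimator_ae_eq {g : ℝ → ℝ} {φs : ℝ → ℂ} {h : ℝ} (hr : MemLp (cutoffRatio g φs h) 2)
    {ν : Measure ℝ} [IsProbabilityMeasure ν] (hν : ν ≪ volume) (n : ℕ) :
    (fun Y : Fin n → ℝ => estimator g φs h Y) =ᵐ[Measure.pi fun _ => ν]
      fun Y => (n : ℂ)⁻¹ * ∑ j, plancherelKernel (cutoffRatio g φs h) (Y j) := by
  by_cases hi : Integrable (cutoffRatio g φs h)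
  · have hker : ∀ᵐ Y ∂(Measure.pi fun _ : Fin n => ν), ∀ j,
        plancherelKernel (cutoffRatio g φs h) (Y j) = (2 * Real.pi : ℂ)⁻¹ *
          ∫ ω : ℝ, Complex.exp (Complex.I * (ω * Y j : ℝ)) * cutoffRatio g φs h ω :=
      ae_all_iff.2 fun j => (measurePreserving_eval (fun _ : Fin n => ν)
        j).quasiMeasurePreserving.ae (hν.ae_le (plancherelKernel_ae_eq hi hr))
    filter_upwards [hker] with Y hY
    rw [estimator, if_pos hi, integral_empFt_mul hi]
    simp only [hY, ← Finset.mul_sum]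
    ring
  · exact .of_forall fun Y => if_neg hi

theorem measurableSet_cutoff (h : ℝ) : MeasurableSet {ω : ℝ | h * |ω| ≤ 1} :=
  measurableSet_le (by fun_prop) measurable_const

theorem cutoffRatio_eq_indicator (g : ℝ → ℝ) (φs : ℝ → ℂ) (h : ℝ) :
    cutoffRatio g φs h =
      {ω : ℝ | h * |ω| ≤ 1}.indicator fun ω => φs (-ω) / ft g ω := by
  ext ω
  simp only [cutoffRatio, Set.indicator, Set.mem_ofPred_eq]

theorem integral_mul_ft_mul_cutoffRatio {g : ℝ → ℝ} (hg₀ : ∀ ω, ft g ω ≠ 0) (t φs : ℝ → ℂ)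
    (h : ℝ) : ∫ ω, t ω * ft g ω * cutoffRatio g φs h ω =
      ∫ ω in {ω : ℝ | h * |ω| ≤ 1}, t ω * φs (-ω) := by
  rw [← integral_indicator (measurableSet_cutoff h), cutoffRatio_eq_indicator]
  congr 1 with ω
  by_cases hω : ω ∈ {ω : ℝ | h * |ω| ≤ 1}
  · have := hg₀ ω
    rw [Set.indicator_of_mem hω, Set.indicator_of_mem hω]
    field_simp
  · rw [Set.indicator_of_notMem hω, Set.indicator_of_notMem hω, mul_zero]

theorem norm_setIntegral_cutoff_sub_integral_le {v : ℝ → ℂ} (hv : Integrable v) (h : ℝ) :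
    ‖(∫ ω in {ω : ℝ | h * |ω| ≤ 1}, v ω) - ∫ ω, v ω‖ ≤ ∫ ω in {ω : ℝ | 1 < h * |ω|}, ‖v ω‖ := by
  have hcompl : {ω : ℝ | h * |ω| ≤ 1}ᶜ = {ω : ℝ | 1 < h * |ω|} := by
    ext ω
    simp
  rw [← integral_add_compl (measurableSet_cutoff h) hv, sub_add_cancel_left, norm_neg, hcompl]
  exact norm_integral_le_integral_norm _

theorem worstRisk_le {F : Set (ℝ → ℝ)} (hF : ∀ f ∈ F, IsPdf f) {g : ℝ → ℝ} (hg : IsPdf g) {M : ℝ}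
    (hM : ∀ x, g x ≤ M) (hg₀ : ∀ ω, ft g ω ≠ 0) {Φ : (ℝ → ℝ) → ℂ} {φs : ℝ → ℂ}
    (hΦ : IsRepresentedOn F Φ φs) {h : ℝ} (hr : MemLp (cutoffRatio g φs h) 2) {J : ℝ}
    (hJ : ∀ f ∈ F, (∫ ω in {ω : ℝ | 1 < h * |ω|}, ‖ft f ω * φs (-ω)‖) ^ 2 ≤ J) {n : ℕ}
    (hn : n ≠ 0) :
    worstRisk F g Φ φs n h ≤ ENNReal.ofReal
      ((n : ℝ)⁻¹ * (M * ((2 * Real.pi)⁻¹ * ∫ ω, ‖cutoffRatio g φs h ω‖ ^ 2)) +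
        (2 * Real.pi)⁻¹ ^ 2 * J) := by
  refine iSup₂_le fun f hf => ?_
  obtain ⟨q, hq, hqM, hlaw⟩ := exists_isPdf_sumLaw_eq_law (hF f hf) hg hM
  have := hq.isProbabilityMeasure_law
  have hftq (ω : ℝ) : ft q ω = ft f ω * ft g ω := by
    rw [← hq.charFun_law, ← hlaw, charFun_sumLaw (hF f hf) hg]
  have hM₀ : 0 ≤ M := (hg.nonneg 0).trans (hM 0)
  have hkernel := memLp_plancherelKernel hr
  have hvar : ∫ y, ‖plancherelKernel (cutoffRatio g φs h) y‖ ^ 2 ∂(law q) ≤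
      M * ((2 * Real.pi)⁻¹ * ∫ ω, ‖cutoffRatio g φs h ω‖ ^ 2) := by
    rw [← integral_norm_sq_plancherelKernel hr]
    exact integral_norm_sq_law_le hM₀ hqM hkernel
  have hbias : ‖∫ y, plancherelKernel (cutoffRatio g φs h) y ∂(law q) - Φ f‖ ^ 2 ≤
      (2 * Real.pi)⁻¹ ^ 2 * J := by
    obtain ⟨hint, hΦf⟩ := hΦ f hf
    have h2π : ‖(2 * Real.pi : ℂ)⁻¹‖ = (2 * Real.pi)⁻¹ := by
      simp [abs_of_pos Real.pi_pos]
    rw [integral_plancherelKernel hq hqM hr, hΦf, ← mul_sub, norm_mul, h2π, mul_pow]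
    simp only [hftq]
    rw [integral_mul_ft_mul_cutoffRatio hg₀]
    gcongr
    exact (pow_le_pow_left₀ (norm_nonneg _)
      (norm_setIntegral_cutoff_sub_integral_le hint h) 2).trans (hJ f hf)
  have hac : law q ≪ volume := withDensity_absolutelyContinuous _ _
  have hae := estimator_ae_eq hr hac n
  calc ∫⁻ Y, ‖estimator g φs h Y - Φ f‖ₑ ^ 2 ∂(sampleLaw f g n)
      = ∫⁻ Y, ‖(n : ℂ)⁻¹ * ∑ j, plancherelKernel (cutoffRatio g φs h) (Y j) - Φ f‖ₑ ^ 2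
          ∂(Measure.pi fun _ => law q) := by
        rw [sampleLaw_eq_pi_sumLaw, hlaw]
        exact lintegral_congr_ae (hae.fun_comp fun z => ‖z - Φ f‖ₑ ^ 2)
    _ ≤ _ := lintegral_sampleMean_sub_sq_le hn (memLp_law hqM hkernel) _
    _ ≤ _ := ENNReal.ofReal_le_ofReal (by gcongr)

end BiasVariance

section UniformBoundedness

theorem lowerSemicontinuous_lintegral {α X : Type*} [MeasurableSpace α] {μ : Measure α}
    [TopologicalSpace X] [SequentialSpace X] {H : X → α → ℝ≥0∞} (hm : ∀ u, AEMeasurable (H u) μ)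
    (hc : ∀ ω, Continuous fun u => H u ω) : LowerSemicontinuous fun u => ∫⁻ ω, H u ω ∂μ := by
  refine lowerSemicontinuous_iff_isClosed_preimage.2 fun c => IsSeqClosed.isClosed fun u v hu huv =>
    ?_
  calc ∫⁻ ω, H v ω ∂μ
      = ∫⁻ ω, liminf (fun k => H (u k) ω) atTop ∂μ :=
        lintegral_congr fun ω => (((hc ω).tendsto v).comp huv).liminf_eq.symm
    _ ≤ liminf (fun k => ∫⁻ ω, H (u k) ω ∂μ) atTop := lintegral_liminf_le' fun k => hm _
    _ ≤ c := liminf_le_of_frequently_le' (.of_forall hu)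

theorem convex_setOf_lintegral_ofReal_le {α X : Type*} [MeasurableSpace α] {μ : Measure α}
    [AddCommGroup X] [Module ℝ X] {H : X → α → ℝ}
    (hm : ∀ u, AEMeasurable (H u) μ) (h₀ : ∀ u ω, 0 ≤ H u ω)
    (hH : ∀ ω, ConvexOn ℝ Set.univ fun u => H u ω) (c : ℝ≥0∞) :
    Convex ℝ {u | ∫⁻ ω, ENNReal.ofReal (H u ω) ∂μ ≤ c} := by
  intro u hu v hv a b ha hb hab
  have hpt (ω : α) : ENNReal.ofReal (H (a • u + b • v) ω) ≤
      ENNReal.ofReal a * ENNReal.ofReal (H u ω) + ENNReal.ofReal b * ENNReal.ofReal (H v ω) := by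
    rw [← ENNReal.ofReal_mul ha, ← ENNReal.ofReal_mul hb,
      ← ENNReal.ofReal_add (mul_nonneg ha (h₀ u ω)) (mul_nonneg hb (h₀ v ω))]
    exact ENNReal.ofReal_le_ofReal ((hH ω).2 trivial trivial ha hb hab)
  calc ∫⁻ ω, ENNReal.ofReal (H (a • u + b • v) ω) ∂μ
      ≤ ∫⁻ ω, (ENNReal.ofReal a * ENNReal.ofReal (H u ω) +
          ENNReal.ofReal b * ENNReal.ofReal (H v ω)) ∂μ := lintegral_mono hpt
    _ = ENNReal.ofReal a * ∫⁻ ω, ENNReal.ofReal (H u ω) ∂μ +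
          ENNReal.ofReal b * ∫⁻ ω, ENNReal.ofReal (H v ω) ∂μ := by
        rw [lintegral_add_left' ((hm u).ennreal_ofReal.const_mul _),
          lintegral_const_mul' _ _ ENNReal.ofReal_ne_top,
          lintegral_const_mul' _ _ ENNReal.ofReal_ne_top]
    _ ≤ ENNReal.ofReal a * c + ENNReal.ofReal b * c := by gcongr <;> assumption
    _ = c := by rw [← add_mul, ← ENNReal.ofReal_add ha hb, hab, ENNReal.ofReal_one, one_mul]

theorem exists_forall_dist_lt_le_of_lowerSemicontinuous {X : Type*} [PseudoMetricSpace X]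
    [CompleteSpace X] {S : Set X} (hS : IsClosed S) (hne : S.Nonempty) {p : X → ℝ≥0∞}
    (hp : LowerSemicontinuous p) (hfin : ∀ u ∈ S, p u < ∞) :
    ∃ m : ℕ, ∃ u₀ ∈ S, ∃ r > 0, ∀ u ∈ S, dist u u₀ < r → p u ≤ m := by
  have : CompleteSpace S := hS.completeSpace_coe
  have : Nonempty S := hne.to_subtype
  have hcover : ⋃ m : ℕ, {u : S | p u ≤ m} = Set.univ :=
    Set.eq_univ_of_forall fun u =>
      let ⟨m, hm⟩ := ENNReal.exists_nat_gt (hfin u u.2).ne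
      Set.mem_iUnion.2 ⟨m, hm.le⟩
  obtain ⟨m, u₀, hu₀⟩ := nonempty_interior_of_iUnion_of_closed
    (fun m : ℕ => (hp.isClosed_preimage m).preimage continuous_subtype_val) hcover
  obtain ⟨r, hr, hball⟩ := Metric.isOpen_iff.1 isOpen_interior u₀ hu₀
  exact ⟨m, u₀, u₀.2, r, hr, fun u hu hd =>
    interior_subset (s := {u : S | p u ≤ m}) (hball (show ⟨u, hu⟩ ∈ Metric.ball u₀ r from hd))⟩

theorem exists_nnreal_forall_le_of_lowerSemicontinuous {X : Type*} [NormedAddCommGroup X]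
    [NormedSpace ℝ X] [CompleteSpace X] {S : Set X} (hclosed : IsClosed S) (hconv : Convex ℝ S)
    (hbdd : Bornology.IsBounded S) {p : X → ℝ≥0∞} (hp : LowerSemicontinuous p)
    (hadd : ∀ u v, p (u + v) ≤ p u + p v) (hsmul : ∀ (c : ℝ) u, p (c • u) ≤ ‖c‖ₑ * p u)
    (hfin : ∀ u ∈ S, p u < ∞) : ∃ C : NNReal, ∀ u ∈ S, p u ≤ C := by
  obtain rfl | hne := S.eq_empty_or_nonempty
  · exact ⟨0, by simp⟩
  obtain ⟨m, u₀, hu₀, r, hr, hball⟩ :=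
    exists_forall_dist_lt_le_of_lowerSemicontinuous hclosed hne hp hfin
  obtain ⟨D, hD⟩ := Metric.isBounded_iff.1 hbdd
  have hD₀ : 0 ≤ D := dist_nonneg.trans (hD hu₀ hu₀)
  obtain ⟨t, ht, ht₁, htD⟩ : ∃ t > 0, t ≤ 1 ∧ t * D < r := by
    refine ⟨r / (D + r + 1), by positivity, (div_le_one (by positivity)).2 (by linarith), ?_⟩
    rw [div_mul_eq_mul_div, div_lt_iff₀ (by positivity)]
    nlinarith
  refine ⟨‖t⁻¹‖₊ * (m + ‖t - 1‖₊ * m), fun u hu => ?_⟩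
  have hvS : u₀ + t • (u - u₀) ∈ S := hconv.add_smul_sub_mem hu₀ hu ⟨ht.le, ht₁⟩
  have hvr : dist (u₀ + t • (u - u₀)) u₀ < r := by
    rw [dist_self_add_left, norm_smul, Real.norm_of_nonneg ht.le, ← dist_eq_norm]
    exact (mul_le_mul_of_nonneg_left (hD hu hu₀) ht.le).trans_lt htD
  calc p u = p (t⁻¹ • ((u₀ + t • (u - u₀)) + (t - 1) • u₀)) := by
        congr 1
        rw [eq_inv_smul_iff₀ ht.ne']
        module
    _ ≤ ‖t⁻¹‖ₑ * (p (u₀ + t • (u - u₀)) + ‖t - 1‖ₑ * p u₀) := by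
        refine (hsmul _ _).trans ?_
        gcongr
        exact (hadd _ _).trans (by gcongr; exact hsmul _ _)
    _ ≤ ‖t⁻¹‖ₑ * (m + ‖t - 1‖ₑ * m) := by
        gcongr
        · exact hball _ hvS hvr
        · exact hball _ hu₀ (by rwa [dist_self])
    _ = _ := by simp [enorm_eq_nnnorm]

/-- The Fourier transform at the frequency `ω`, as a continuous linear functional on `L¹`. -/
noncomputable def ftL1 (ω : ℝ) : Lp ℝ 1 (volume : Measure ℝ) →L[ℝ] ℂ :=
  (BoundedContinuousFunction.evalCLM ℝ (-((2 * Real.pi)⁻¹ * ω))).comp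
    (((Real.Lp.fourierTransformCLM ℝ ℂ).restrictScalars ℝ).comp
      (Complex.ofRealCLM.compLpL 1 volume))

theorem ft_congr_ae {t u : ℝ → ℝ} (h : t =ᵐ[volume] u) (ω : ℝ) : ft t ω = ft u ω :=
  integral_congr_ae (h.mono fun x hx => by simp only [hx])

theorem fourier_ofReal (t : ℝ → ℝ) (ω : ℝ) :
    𝓕 (fun x => (t x : ℂ)) (-((2 * Real.pi)⁻¹ * ω)) = ft t ω := by
  rw [Real.fourier_real_eq_integral_exp_smul, ft]
  congr 1 with x
  rw [smul_eq_mul]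
  congr 2
  push_cast
  field_simp

theorem ftL1_apply (ω : ℝ) (u : Lp ℝ 1 (volume : Measure ℝ)) : ftL1 ω u = ft u ω := by
  rw [← fourier_ofReal]
  exact Real.fourier_congr_ae (Complex.ofRealCLM.coeFn_compLpL u) _

theorem measurable_ftL1 (u : Lp ℝ 1 (volume : Measure ℝ)) : Measurable fun ω => ftL1 ω u := by
  simp only [ftL1_apply, ← fourier_ofReal]
  have := continuous_fourier (V := ℝ) (F := ℂ) (L1.integrable_coeFn u).ofReal
  exact (this.comp (by fun_prop)).measurable

/-- The classes in `L¹` of the densities in `sobolevBall s B`. -/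
def sobolevBallL1 (s B : ℝ) : Set (Lp ℝ 1 (volume : Measure ℝ)) :=
  {u | 0 ≤ u} ∩ {u | L1.integralCLM u = 1} ∩
    {u | ∫⁻ ω : ℝ, ENNReal.ofReal (‖ftL1 ω u‖ ^ 2 * (ω ^ 2 + 1) ^ s) ≤ ENNReal.ofReal (B ^ 2)}

theorem measurable_norm_sq_ftL1_mul (s : ℝ) (u : Lp ℝ 1 (volume : Measure ℝ)) :
    Measurable fun ω : ℝ => ‖ftL1 ω u‖ ^ 2 * (ω ^ 2 + 1) ^ s := by
  have := measurable_ftL1 u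
  fun_prop

theorem isClosed_sobolevBallL1 (s B : ℝ) : IsClosed (sobolevBallL1 s B) := by
  refine (isClosed_Ici.inter (isClosed_eq (by fun_prop) continuous_const)).inter ?_
  have (ω : ℝ) : Continuous fun u => ENNReal.ofReal (‖ftL1 ω u‖ ^ 2 * (ω ^ 2 + 1) ^ s) :=
    ENNReal.continuous_ofReal.comp (by fun_prop)
  exact (lowerSemicontinuous_lintegral
    (fun u => (measurable_norm_sq_ftL1_mul s u).ennreal_ofReal.aemeasurable)
    this).isClosed_preimage _

theorem convex_setOf_L1_nonneg : Convex ℝ {u : Lp ℝ 1 (volume : Measure ℝ) | 0 ≤ u} := by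
  intro u hu v hv a b ha hb _
  rw [Set.mem_ofPred_eq, ← Lp.coeFn_nonneg] at hu hv ⊢
  filter_upwards [Lp.coeFn_add (a • u) (b • v), Lp.coeFn_smul a u, Lp.coeFn_smul b v, hu, hv]
    with x hadd hau hbv hux hvx
  rw [hadd, Pi.add_apply, hau, hbv]
  exact add_nonneg (mul_nonneg ha hux) (mul_nonneg hb hvx)

theorem convex_sobolevBallL1 (s B : ℝ) : Convex ℝ (sobolevBallL1 s B) := by
  refine (convex_setOf_L1_nonneg.inter
    ((convex_singleton 1).linear_preimage (L1.integralCLM (E := ℝ)).toLinearMap)).inter ?_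
  refine convex_setOf_lintegral_ofReal_le
    (fun u => (measurable_norm_sq_ftL1_mul s u).aemeasurable) (fun u ω => by positivity)
    (fun ω => ?_) _
  have hnorm : ConvexOn ℝ Set.univ fun u => ‖ftL1 ω u‖ :=
    convexOn_univ_norm.comp_linearMap (ftL1 ω).toLinearMap
  refine ((hnorm.pow (fun u _ => norm_nonneg _) 2).smul
    (c := (ω ^ 2 + 1) ^ s) (by positivity)).congr fun u _ => ?_
  simp [mul_comm]

theorem isBounded_sobolevBallL1 (s B : ℝ) : Bornology.IsBounded (sobolevBallL1 s B) := by
  refine isBounded_iff_forall_norm_le.2 ⟨1, ?_⟩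
  rintro u ⟨⟨hu₀, hu₁⟩, -⟩
  rw [Set.mem_ofPred_eq, ← L1.integral_eq, L1.integral_eq_integral] at hu₁
  rw [L1.norm_eq_integral_norm, ← hu₁]
  exact (integral_congr_ae <| ((Lp.coeFn_nonneg u).2 hu₀).mono fun x hx =>
    Real.norm_of_nonneg hx).le

theorem toL1_mem_sobolevBallL1 {s B : ℝ} {f : ℝ → ℝ} (hf : f ∈ sobolevBall s B) :
    hf.1.integrable.toL1 f ∈ sobolevBallL1 s B := by
  have hae := hf.1.integrable.coeFn_toL1
  refine ⟨⟨?_, ?_⟩, ?_⟩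
  · exact (Lp.coeFn_nonneg _).1 (hae.mono fun x hx => (hf.1.nonneg x).trans_eq hx.symm)
  · rw [Set.mem_ofPred_eq, ← L1.integral_eq, L1.integral_eq_integral, integral_congr_ae hae,
      integral_eq_lintegral_of_nonneg_ae (.of_forall hf.1.nonneg) hf.1.integrable.1,
      hf.1.lintegral_eq_one, ENNReal.toReal_one]
  · simpa only [Set.mem_ofPred_eq, ftL1_apply, ft_congr_ae hae] using hf.2

theorem exists_mem_sobolevBall_ae_eq {s B : ℝ} {u : Lp ℝ 1 (volume : Measure ℝ)}
    (hu : u ∈ sobolevBallL1 s B) : ∃ f ∈ sobolevBall s B, f =ᵐ[volume] u := by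
  obtain ⟨⟨hu₀, hu₁⟩, hu₂⟩ := hu
  replace hu₀ := (Lp.coeFn_nonneg u).2 hu₀
  rw [Set.mem_ofPred_eq, ← L1.integral_eq, L1.integral_eq_integral] at hu₁
  have hmeas : Measurable (u : ℝ → ℝ) := (Lp.stronglyMeasurable u).measurable
  have hae : (fun x => max (u x) 0) =ᵐ[volume] u := hu₀.mono fun x hx => max_eq_left hx
  refine ⟨fun x => max (u x) 0, ⟨⟨hmeas.max measurable_const, fun x => le_max_right _ _, ?_⟩, ?_⟩,
    hae⟩
  · rw [← integral_congr_ae hae] at hu₁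
    rw [← ofReal_integral_eq_lintegral_ofReal
      ((L1.integrable_coeFn u).congr hae.symm) (.of_forall fun x => le_max_right _ _), hu₁,
      ENNReal.ofReal_one]
  · simpa only [ft_congr_ae hae, Set.mem_ofPred_eq, ftL1_apply] using hu₂

theorem exists_forall_integral_norm_ft_mul_le {s B : ℝ} {k : ℝ → ℂ} (hk : Measurable k)
    (hint : ∀ f ∈ sobolevBall s B, Integrable fun ω => ft f ω * k ω) :
    ∃ C : ℝ, ∀ f ∈ sobolevBall s B, ∫ ω, ‖ft f ω * k ω‖ ≤ C := by
  have hmeas (u : Lp ℝ 1 (volume : Measure ℝ)) : Measurable fun ω => ‖ftL1 ω u * k ω‖ₑ := by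
    have := measurable_ftL1 u
    fun_prop
  obtain ⟨C, hC⟩ := exists_nnreal_forall_le_of_lowerSemicontinuous (isClosed_sobolevBallL1 s B)
    (convex_sobolevBallL1 s B) (isBounded_sobolevBallL1 s B)
    (p := fun u => ∫⁻ ω, ‖ftL1 ω u * k ω‖ₑ)
    (lowerSemicontinuous_lintegral (fun u => (hmeas u).aemeasurable) fun ω => by fun_prop)
    (fun u v => by
      rw [← lintegral_add_left (hmeas u)]
      refine lintegral_mono fun ω => ?_
      rw [map_add, add_mul]
      exact enorm_add_le _ _)
    (fun c u => by
      rw [← lintegral_const_mul' _ _ enorm_ne_top]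
      refine lintegral_mono fun ω => ?_
      rw [map_smul, smul_mul_assoc, enorm_smul])
    (fun u hu => by
      obtain ⟨f, hf, hae⟩ := exists_mem_sobolevBall_ae_eq hu
      simpa only [hasFiniteIntegral_iff_enorm, ft_congr_ae hae, ← ftL1_apply] using (hint f hf).2)
  refine ⟨C, fun f hf => ?_⟩
  have hle := hC _ (toL1_mem_sobolevBallL1 hf)
  simp only [ftL1_apply, ft_congr_ae hf.1.integrable.coeFn_toL1] at hle
  rw [integral_norm_eq_lintegral_enorm (hint f hf).1]
  exact ENNReal.toReal_le_coe_of_le_coe hle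

end UniformBoundedness

section Weights

theorem lintegral_comp_abs {v : ℝ → ℝ≥0∞} (hv : Measurable v) :
    ∫⁻ ω : ℝ, v |ω| = 2 * ∫⁻ t in Set.Ioi (0 : ℝ), v t := by
  have hpos : ∫⁻ ω in Set.Ioi (0 : ℝ), v |ω| = ∫⁻ t in Set.Ioi (0 : ℝ), v t :=
    setLIntegral_congr_fun measurableSet_Ioi fun ω hω => by
      simp only [abs_of_pos (Set.mem_Ioi.1 hω)]
  have hneg : ∫⁻ ω in Set.Iic (0 : ℝ), v |ω| = ∫⁻ t in Set.Ioi (0 : ℝ), v t := by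
    have hreflect := (Measure.measurePreserving_neg (volume : Measure ℝ)).setLIntegral_comp_preimage
      (s := Set.Ici (0 : ℝ)) measurableSet_Ici hv
    rw [Set.neg_preimage, Set.neg_Ici, neg_zero] at hreflect
    rw [setLIntegral_congr Ioi_ae_eq_Ici, ← hreflect]
    exact setLIntegral_congr_fun measurableSet_Iic fun ω hω => by
      simp only [abs_of_nonpos (Set.mem_Iic.1 hω)]
  rw [← lintegral_add_compl (fun ω : ℝ => v |ω|) (measurableSet_Ioi (a := (0 : ℝ))),
    Set.compl_Ioi, hpos, hneg, two_mul]

theorem setLIntegral_comp_abs {v : ℝ → ℝ≥0∞} (hv : Measurable v) {S : Set ℝ}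
    (hS : MeasurableSet S) :
    ∫⁻ ω in {ω : ℝ | |ω| ∈ S}, v |ω| = 2 * ∫⁻ t in Set.Ioi (0 : ℝ) ∩ S, v t := by
  have hS' : MeasurableSet {ω : ℝ | |ω| ∈ S} := hS.preimage continuous_abs.measurable
  rw [← lintegral_indicator hS', Set.inter_comm, ← Measure.restrict_restrict hS,
    ← lintegral_indicator hS, ← lintegral_comp_abs (hv.indicator hS)]
  rfl

/-- The function `(t² + 1)^p exp(P t^x + Q t^y)` of `t > 0`. The variance and the squared bias of
the cut-off estimator are controlled by integrals of such weights. -/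
noncomputable def weight (p P x Q y t : ℝ) : ℝ :=
  (t ^ 2 + 1) ^ p * Real.exp (P * t ^ x + Q * t ^ y)

theorem weight_nonneg (p P x Q y t : ℝ) : 0 ≤ weight p P x Q y t := by
  unfold weight
  positivity

theorem measurable_weight (p P x Q y : ℝ) : Measurable (weight p P x Q y) := by
  unfold weight
  fun_prop

/-- The function `C (ω² + 1)^(-p/2) exp(-P |ω|^x)`, the shape of the bounds on `φ*` and `g*`. -/
noncomputable def envelope (C p P x ω : ℝ) : ℝ :=
  C * (ω ^ 2 + 1) ^ (-p / 2) * Real.exp (-P * |ω| ^ x)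

theorem envelope_pos {C : ℝ} (hC : 0 < C) (p P x ω : ℝ) : 0 < envelope C p P x ω := by
  unfold envelope
  positivity

theorem envelope_neg (C p P x ω : ℝ) : envelope C p P x (-ω) = envelope C p P x ω := by
  rw [envelope, envelope, neg_sq, abs_neg]

theorem envelope_mul_rpow (C p P x s ω : ℝ) :
    envelope C p P x ω * (ω ^ 2 + 1) ^ (-s / 2) = envelope C (s + p) P x ω := by
  have hpos : 0 < ω ^ 2 + 1 := by positivity
  have hexp : (ω ^ 2 + 1) ^ (-(s + p) / 2) = (ω ^ 2 + 1) ^ (-p / 2) * (ω ^ 2 + 1) ^ (-s / 2) := by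
    rw [← Real.rpow_add hpos]
    ring_nf
  rw [envelope, envelope, hexp]
  ring

theorem envelope_sq (C p P x ω : ℝ) :
    envelope C p P x ω ^ 2 = C ^ 2 * weight (-p) (-2 * P) x 0 0 |ω| := by
  rw [envelope, weight, mul_pow, mul_pow, ← Real.exp_nat_mul,
    ← Real.rpow_mul_natCast (by positivity), sq_abs, mul_assoc]
  congr 3 <;> push_cast <;> ring

theorem envelope_div_sq (C p P x C' p' P' x' ω : ℝ) :
    (envelope C p P x ω / envelope C' p' P' x' ω) ^ 2 =
      (C / C') ^ 2 * weight (p' - p) (2 * P') x' (-2 * P) x |ω| := by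
  have hpos : 0 < ω ^ 2 + 1 := by positivity
  rw [div_pow, envelope_sq, envelope_sq, mul_div_mul_comm, ← div_pow]
  simp only [weight, sq_abs, zero_mul, add_zero]
  rw [mul_div_mul_comm, ← Real.rpow_sub hpos, ← Real.exp_sub]
  ring_nf

end Weights

section RiskBounds

/-- The one-sided integral of the upper bound for `|φ*(-ω) / g*(ω)|²` over the frequencies
`h |ω| ≤ 1`, where `A₂ = α - a`. It controls the variance of the cut-off estimator. -/
noncomputable def varianceIntegral (A₂ b d β γ h : ℝ) : ℝ≥0∞ :=
  ∫⁻ t in Set.Ioi 0 ∩ {t : ℝ | h * t ≤ 1}, ENNReal.ofReal (weight A₂ (2 * γ) β (-2 * d) b t)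

/-- The one-sided integral of the upper bound for `|φ*(-ω)|² (ω² + 1)^(-s)` over the frequencies
`h |ω| > 1`, where `σ = s + a`. It controls the squared bias of the cut-off estimator. -/
noncomputable def biasIntegral (σ b d h : ℝ) : ℝ≥0∞ :=
  ∫⁻ t in Set.Ioi 0 ∩ {t : ℝ | 1 < h * t}, ENNReal.ofReal (weight (-σ) (-2 * d) b 0 0 t)

theorem memLp_two_and_integral_norm_sq_le {X E : Type*} [MeasurableSpace X]
    [NormedAddCommGroup E] {μ : Measure X} {r : X → E} (hr : AEStronglyMeasurable r μ) {I : ℝ}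
    (hI : 0 ≤ I) (h : ∫⁻ x, ‖r x‖ₑ ^ 2 ∂μ ≤ ENNReal.ofReal I) :
    MemLp r 2 μ ∧ ∫ x, ‖r x‖ ^ 2 ∂μ ≤ I := by
  have henorm (x : X) : ‖‖r x‖ ^ 2‖ₑ = ‖r x‖ₑ ^ 2 := by rw [enorm_pow, enorm_norm]
  have hint : Integrable (fun x => ‖r x‖ ^ 2) μ := by
    refine ⟨hr.norm.pow 2, ?_⟩
    simp only [HasFiniteIntegral, henorm]
    exact h.trans_lt ENNReal.ofReal_lt_top
  refine ⟨(memLp_two_iff_integrable_sq_norm hr).2 hint, ?_⟩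
  rw [integral_eq_lintegral_of_nonneg_ae (.of_forall fun x => by positivity) hint.1]
  refine ENNReal.toReal_le_of_le_ofReal hI ?_
  simpa only [ENNReal.ofReal_pow (norm_nonneg _), ofReal_norm] using h

theorem sq_lintegral_mul_le {X : Type*} [MeasurableSpace X] {μ : Measure X} {u v : X → ℝ≥0∞}
    (hu : AEMeasurable u μ) (hv : AEMeasurable v μ) :
    (∫⁻ x, u x * v x ∂μ) ^ 2 ≤ (∫⁻ x, u x ^ 2 ∂μ) * ∫⁻ x, v x ^ 2 ∂μ := by
  have hsq (c : ℝ≥0∞) : (c ^ (1 / (2 : ℝ))) ^ 2 = c := by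
    rw [← ENNReal.rpow_natCast, ← ENNReal.rpow_mul]
    norm_num
  have hHolder := ENNReal.lintegral_mul_le_Lp_mul_Lq μ Real.HolderConjugate.two_two hu hv
  simp only [Pi.mul_apply, ENNReal.rpow_two] at hHolder
  refine (pow_le_pow_left' hHolder 2).trans_eq ?_
  rw [mul_pow, hsq, hsq]

variable {a b d Cφ : ℝ} {φs : ℝ → ℂ}

theorem lintegral_enorm_sq_cutoffRatio_le {α β γ Cg : ℝ} (hCg : 0 < Cg) {g : ℝ → ℝ}
    (hg_low : ∀ ω, envelope Cg α γ β ω ≤ ‖ft g ω‖) (hφ_up : ∀ ω, ‖φs ω‖ ≤ envelope Cφ a d b ω)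
    (h : ℝ) :
    ∫⁻ ω, ‖cutoffRatio g φs h ω‖ₑ ^ 2 ≤
      ENNReal.ofReal ((Cφ / Cg) ^ 2) * (2 * varianceIntegral (α - a) b d β γ h) := by
  have hratio (ω : ℝ) : ‖φs (-ω) / ft g ω‖ₑ ^ 2 ≤ ENNReal.ofReal ((Cφ / Cg) ^ 2) *
      ENNReal.ofReal (weight (α - a) (2 * γ) β (-2 * d) b |ω|) := by
    have hup : ‖φs (-ω)‖ ≤ envelope Cφ a d b ω := envelope_neg Cφ a d b ω ▸ hφ_up (-ω)
    rw [← ENNReal.ofReal_mul (by positivity), ← envelope_div_sq, ← ofReal_norm,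
      ← ENNReal.ofReal_pow (norm_nonneg _), norm_div]
    gcongr
    · exact (norm_nonneg _).trans hup
    · exact envelope_pos hCg α γ β ω
    · exact hg_low ω
  have hS : MeasurableSet {t : ℝ | h * t ≤ 1} := measurableSet_le (by fun_prop) measurable_const
  have hw := (measurable_weight (α - a) (2 * γ) β (-2 * d) b).ennreal_ofReal
  have hw_abs : Measurable fun ω : ℝ => ENNReal.ofReal (weight (α - a) (2 * γ) β (-2 * d) b |ω|) :=
    hw.comp continuous_abs.measurable
  calc ∫⁻ ω, ‖cutoffRatio g φs h ω‖ₑ ^ 2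
      = ∫⁻ ω in {ω : ℝ | h * |ω| ≤ 1}, ‖φs (-ω) / ft g ω‖ₑ ^ 2 := by
        rw [cutoffRatio_eq_indicator, ← lintegral_indicator (measurableSet_cutoff h)]
        congr 1 with ω
        by_cases hω : ω ∈ {ω : ℝ | h * |ω| ≤ 1} <;> simp [hω]
    _ ≤ ∫⁻ ω in {ω : ℝ | h * |ω| ≤ 1}, ENNReal.ofReal ((Cφ / Cg) ^ 2) *
          ENNReal.ofReal (weight (α - a) (2 * γ) β (-2 * d) b |ω|) := lintegral_mono hratio
    _ = _ := by
      rw [lintegral_const_mul _ hw_abs]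
      congr 1
      exact setLIntegral_comp_abs hw hS

theorem memLp_cutoffRatio {α β γ Cg : ℝ} (hCg : 0 < Cg) {g : ℝ → ℝ} (hg : IsPdf g)
    (hg_low : ∀ ω, envelope Cg α γ β ω ≤ ‖ft g ω‖) (hφ : Measurable φs)
    (hφ_up : ∀ ω, ‖φs ω‖ ≤ envelope Cφ a d b ω) {h I : ℝ} (hI : 0 ≤ I)
    (hvar : varianceIntegral (α - a) b d β γ h ≤ ENNReal.ofReal I) :
    MemLp (cutoffRatio g φs h) 2 ∧
      ∫ ω, ‖cutoffRatio g φs h ω‖ ^ 2 ≤ (Cφ / Cg) ^ 2 * (2 * I) := by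
  have hφ_neg : Measurable fun ω => φs (-ω) := by fun_prop
  have hmeas : Measurable (cutoffRatio g φs h) := by
    rw [cutoffRatio_eq_indicator]
    exact (hφ_neg.div hg.continuous_ft.measurable).indicator (measurableSet_cutoff h)
  refine memLp_two_and_integral_norm_sq_le hmeas.aestronglyMeasurable (by positivity) ?_
  refine (lintegral_enorm_sq_cutoffRatio_le hCg hg_low hφ_up h).trans ?_
  rw [ENNReal.ofReal_mul (by positivity), ENNReal.ofReal_mul (by norm_num), ENNReal.ofReal_ofNat]
  gcongr

theorem sq_setLIntegral_enorm_ft_mul_le {s B : ℝ} (hφ : Measurable φs)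
    (hφ_up : ∀ ω, ‖φs ω‖ ≤ envelope Cφ a d b ω) {f : ℝ → ℝ} (hf : f ∈ sobolevBall s B) (h : ℝ) :
    (∫⁻ ω in {ω : ℝ | 1 < h * |ω|}, ‖ft f ω * φs (-ω)‖ₑ) ^ 2 ≤
      ENNReal.ofReal (B ^ 2) * (ENNReal.ofReal (Cφ ^ 2) * (2 * biasIntegral (s + a) b d h)) := by
  have hft := hf.1.continuous_ft.measurable
  let u (ω : ℝ) : ℝ≥0∞ := ENNReal.ofReal (‖ft f ω‖ * (ω ^ 2 + 1) ^ (s / 2))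
  let v (ω : ℝ) : ℝ≥0∞ := ENNReal.ofReal (‖φs (-ω)‖ * (ω ^ 2 + 1) ^ (-s / 2))
  have huv (ω : ℝ) : ‖ft f ω * φs (-ω)‖ₑ = u ω * v ω := by
    have hpos : 0 < ω ^ 2 + 1 := by positivity
    rw [← ENNReal.ofReal_mul (by positivity), mul_mul_mul_comm, ← Real.rpow_add hpos, ← ofReal_norm,
      norm_mul, neg_div, add_neg_cancel, Real.rpow_zero, mul_one]
  have hu (ω : ℝ) : u ω ^ 2 = ENNReal.ofReal (‖ft f ω‖ ^ 2 * (ω ^ 2 + 1) ^ s) := by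
    rw [← ENNReal.ofReal_pow (by positivity), mul_pow, ← Real.rpow_mul_natCast (by positivity)]
    norm_num
  have hv (ω : ℝ) : v ω ^ 2 ≤ ENNReal.ofReal (Cφ ^ 2) *
      ENNReal.ofReal (weight (-(s + a)) (-2 * d) b 0 0 |ω|) := by
    have hup : ‖φs (-ω)‖ ≤ envelope Cφ a d b ω := envelope_neg Cφ a d b ω ▸ hφ_up (-ω)
    rw [← ENNReal.ofReal_pow (by positivity), ← ENNReal.ofReal_mul (by positivity), ← envelope_sq,
      ← envelope_mul_rpow]
    gcongr
  have hS : MeasurableSet {t : ℝ | 1 < h * t} := measurableSet_lt measurable_const (by fun_prop)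
  have hw := (measurable_weight (-(s + a)) (-2 * d) b 0 0).ennreal_ofReal
  have hw_abs : Measurable fun ω : ℝ => ENNReal.ofReal (weight (-(s + a)) (-2 * d) b 0 0 |ω|) :=
    hw.comp continuous_abs.measurable
  simp only [huv]
  refine (sq_lintegral_mul_le (by fun_prop) (by fun_prop)).trans (mul_le_mul' ?_ ?_)
  · simp only [hu]
    exact (setLIntegral_le_lintegral _ _).trans hf.2
  · refine (lintegral_mono hv).trans_eq ?_
    rw [lintegral_const_mul _ hw_abs]
    congr 1
    exact setLIntegral_comp_abs hw hS

theorem sq_setIntegral_norm_ft_mul_le {s B : ℝ} (hφ : Measurable φs)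
    (hφ_up : ∀ ω, ‖φs ω‖ ≤ envelope Cφ a d b ω) {f : ℝ → ℝ} (hf : f ∈ sobolevBall s B) {h J : ℝ}
    (hJ : 0 ≤ J) (hbias : biasIntegral (s + a) b d h ≤ ENNReal.ofReal J) :
    (∫ ω in {ω : ℝ | 1 < h * |ω|}, ‖ft f ω * φs (-ω)‖) ^ 2 ≤ B ^ 2 * (Cφ ^ 2 * (2 * J)) := by
  have hft := hf.1.continuous_ft.measurable
  rw [integral_norm_eq_lintegral_enorm (by fun_prop), ← ENNReal.toReal_pow]
  refine ENNReal.toReal_le_of_le_ofReal (by positivity) ?_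
  refine (sq_setLIntegral_enorm_ft_mul_le hφ hφ_up hf h).trans ?_
  rw [ENNReal.ofReal_mul (by positivity), ENNReal.ofReal_mul (by positivity),
    ENNReal.ofReal_mul (by norm_num), ENNReal.ofReal_ofNat]
  gcongr

/-- The bias integral may diverge, but only for rates that do not tend to zero. The alternative
`1 ≤ J` covers these, as the bias is bounded uniformly over the class. -/
theorem exists_sq_setIntegral_norm_ft_mul_le {s B : ℝ} (hφ : Measurable φs)
    (hφ_up : ∀ ω, ‖φs ω‖ ≤ envelope Cφ a d b ω)
    (hint : ∀ f ∈ sobolevBall s B, Integrable fun ω => ft f ω * φs (-ω)) :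
    ∃ K : ℝ, 0 ≤ K ∧ ∀ h J : ℝ, 0 ≤ J →
      (biasIntegral (s + a) b d h ≤ ENNReal.ofReal J ∨ 1 ≤ J) → ∀ f ∈ sobolevBall s B,
        (∫ ω in {ω : ℝ | 1 < h * |ω|}, ‖ft f ω * φs (-ω)‖) ^ 2 ≤ K * J := by
  have hφ_neg : Measurable fun ω => φs (-ω) := by fun_prop
  obtain ⟨L, hL⟩ := exists_forall_integral_norm_ft_mul_le hφ_neg hint
  refine ⟨B ^ 2 * (Cφ ^ 2 * 2) + L ^ 2, by positivity, fun h J hJ hbias f hf => ?_⟩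
  have hLJ : 0 ≤ L ^ 2 * J := by positivity
  have hBJ : 0 ≤ B ^ 2 * (Cφ ^ 2 * 2) * J := by positivity
  rcases hbias with hbias | hJ₁
  · linarith [sq_setIntegral_norm_ft_mul_le hφ hφ_up hf hJ hbias]
  · have hle : ∫ ω in {ω : ℝ | 1 < h * |ω|}, ‖ft f ω * φs (-ω)‖ ≤ L :=
      (setIntegral_le_integral (hint f hf).norm (.of_forall fun ω => norm_nonneg _)).trans (hL f hf)
    linarith [pow_le_pow_left₀ (integral_nonneg fun ω => norm_nonneg _) hle 2,
      le_mul_of_one_le_right (sq_nonneg L) hJ₁]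

theorem exists_worstRisk_le {s B α β γ Cg : ℝ} (hCg : 0 < Cg) {g : ℝ → ℝ} (hg : IsPdf g)
    (hg_bdd : BddAbove (Set.range g)) (hg_low : ∀ ω, envelope Cg α γ β ω ≤ ‖ft g ω‖)
    (hφ : Measurable φs) (hφ_up : ∀ ω, ‖φs ω‖ ≤ envelope Cφ a d b ω) {Φ : (ℝ → ℝ) → ℂ}
    (hΦ : IsRepresentedOn (sobolevBall s B) Φ φs) :
    ∃ K : ℝ, 0 < K ∧ ∀ (n : ℕ) (h I J : ℝ), n ≠ 0 → 0 ≤ I → 0 ≤ J →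
      varianceIntegral (α - a) b d β γ h ≤ ENNReal.ofReal I →
      (biasIntegral (s + a) b d h ≤ ENNReal.ofReal J ∨ 1 ≤ J) →
      worstRisk (sobolevBall s B) g Φ φs n h ≤ ENNReal.ofReal (K * ((n : ℝ)⁻¹ * I + J)) := by
  obtain ⟨M, hM⟩ := hg_bdd
  replace hM (x : ℝ) : g x ≤ M := hM ⟨x, rfl⟩
  have hM₀ : 0 ≤ M := (hg.nonneg 0).trans (hM 0)
  have hg₀ (ω : ℝ) : ft g ω ≠ 0 := norm_pos_iff.1 ((envelope_pos hCg α γ β ω).trans_le (hg_low ω))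
  obtain ⟨L, hL₀, hL⟩ := exists_sq_setIntegral_norm_ft_mul_le hφ hφ_up fun f hf => (hΦ f hf).1
  let K₁ := M * ((2 * Real.pi)⁻¹ * ((Cφ / Cg) ^ 2 * 2))
  let K₂ := (2 * Real.pi)⁻¹ ^ 2 * L
  have hK₁ : 0 ≤ K₁ := by positivity
  have hK₂ : 0 ≤ K₂ := by positivity
  refine ⟨K₁ + K₂ + 1, by positivity, fun n h I J hn hI hJ hvar hbias => ?_⟩
  obtain ⟨hr, hrI⟩ := memLp_cutoffRatio hCg hg hg_low hφ hφ_up hI hvar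
  refine (worstRisk_le (fun f hf => hf.1) hg hM hg₀ hΦ hr (hL h J hJ hbias) hn).trans
    (ENNReal.ofReal_le_ofReal ?_)
  have hnI : 0 ≤ (n : ℝ)⁻¹ * I := by positivity
  calc _ ≤ (n : ℝ)⁻¹ * (M * ((2 * Real.pi)⁻¹ * ((Cφ / Cg) ^ 2 * (2 * I)))) +
        (2 * Real.pi)⁻¹ ^ 2 * (L * J) := by gcongr
    _ = K₁ * ((n : ℝ)⁻¹ * I) + K₂ * J := by ring
    _ ≤ _ := by nlinarith [mul_nonneg hK₁ hJ, mul_nonneg hK₂ hnI]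

end RiskBounds

section Comparison

variable {F u : ℝ → ℝ}

theorem setLIntegral_Ioc_le_sub_of_le_deriv {t₀ T : ℝ} (hT : t₀ ≤ T) (hu : ∀ t, 0 ≤ u t)
    (hF : ∀ t ≥ t₀, DifferentiableAt ℝ F t) (huF : ∀ t ≥ t₀, u t ≤ deriv F t) :
    ∫⁻ t in Set.Ioc t₀ T, ENNReal.ofReal (u t) ≤ ENNReal.ofReal (F T - F t₀) := by
  have hcont : ContinuousOn F (Set.Icc t₀ T) := fun t ht =>
    (hF t ht.1).continuousAt.continuousWithinAt
  have hderiv (t : ℝ) (ht : t ∈ Set.Ioo t₀ T) : HasDerivAt F (deriv F t) t :=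
    (hF t ht.1.le).hasDerivAt
  have hnonneg (t : ℝ) (ht : t₀ ≤ t) : 0 ≤ deriv F t := (hu t).trans (huF t ht)
  have hint : IntegrableOn (deriv F) (Set.Ioc t₀ T) :=
    intervalIntegral.integrableOn_deriv_of_nonneg hcont hderiv fun t ht => hnonneg t ht.1.le
  rw [← intervalIntegral.integral_eq_sub_of_hasDerivAt_of_le hT hcont hderiv
      ((intervalIntegrable_iff_integrableOn_Ioc_of_le hT).2 hint),
    intervalIntegral.integral_of_le hT, ofReal_integral_eq_lintegral_ofReal hint
      ((ae_restrict_iff' measurableSet_Ioc).2 (.of_forall fun t ht => hnonneg t ht.1.le))]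
  exact setLIntegral_mono' measurableSet_Ioc fun t ht => ENNReal.ofReal_le_ofReal (huF t ht.1.le)

theorem eventually_setLIntegral_Ioi_le_of_le_neg_deriv (hu : ∀ t, 0 ≤ u t)
    (hF : ∀ᶠ t in atTop, DifferentiableAt ℝ F t) (huF : ∀ᶠ t in atTop, u t ≤ -deriv F t)
    (hF₀ : ∀ᶠ t in atTop, 0 ≤ F t) :
    ∀ᶠ T in atTop, ∫⁻ t in Set.Ioi T, ENNReal.ofReal (u t) ≤ ENNReal.ofReal (F T) := by
  filter_upwards [eventually_forall_ge_atTop.2 (hF.and (huF.and hF₀))] with T hT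
  have hIoi : Set.Ioi T = ⋃ k : ℕ, Set.Ioc T (T + k) := by
    ext t
    simp only [Set.mem_Ioi, Set.mem_iUnion, Set.mem_Ioc]
    refine ⟨fun h => ?_, fun ⟨_, h, _⟩ => h⟩
    obtain ⟨k, hk⟩ := exists_nat_ge (t - T)
    exact ⟨k, h, by linarith⟩
  have hmono : Monotone fun k : ℕ => Set.Ioc T (T + k) := fun i j hij =>
    Set.Ioc_subset_Ioc_right (by gcongr)
  rw [hIoi, setLIntegral_iUnion_of_directed _ hmono.directed_le]
  refine iSup_le fun k => ?_
  have hk : T ≤ T + (k : ℝ) := by simp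
  refine (setLIntegral_Ioc_le_sub_of_le_deriv (F := -F) hk hu (fun t ht => (hT t ht).1.neg)
    fun t ht => ?_).trans (ENNReal.ofReal_le_ofReal ?_)
  · rw [deriv.neg]
    exact (hT t ht).2.1
  · simp only [Pi.neg_apply]
    linarith [(hT _ hk).2.2]

theorem exists_eventually_setLIntegral_Ioc_le_of_le_deriv (hu : ∀ t, 0 ≤ u t)
    (hfin : ∀ T, ∫⁻ t in Set.Ioc 0 T, ENNReal.ofReal (u t) ≠ ∞)
    (hF : ∀ᶠ t in atTop, DifferentiableAt ℝ F t) (huF : ∀ᶠ t in atTop, u t ≤ deriv F t)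
    (hF₀ : ∀ᶠ t in atTop, 0 < F t) :
    ∃ C : ℝ, ∀ᶠ T in atTop,
      ∫⁻ t in Set.Ioc 0 T, ENNReal.ofReal (u t) ≤ ENNReal.ofReal (C * F T) := by
  obtain ⟨t₀, ht₀, h₀⟩ := ((eventually_ge_atTop 0).and
    (eventually_forall_ge_atTop.2 (hF.and (huF.and hF₀)))).exists
  have hmono : MonotoneOn F (Set.Ici t₀) :=
    monotoneOn_of_deriv_nonneg (convex_Ici t₀)
      (fun t ht => (h₀ t ht).1.continuousAt.continuousWithinAt)
      (fun t ht => (h₀ t (interior_subset ht)).1.differentiableWithinAt)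
      fun t ht => (hu t).trans (h₀ t (interior_subset ht)).2.1
  have hpos : 0 < F t₀ := (h₀ t₀ le_rfl).2.2
  set I := (∫⁻ t in Set.Ioc 0 t₀, ENNReal.ofReal (u t)).toReal
  have hI : 0 ≤ I := ENNReal.toReal_nonneg
  refine ⟨I / F t₀ + 1, (eventually_ge_atTop t₀).mono fun T hT => ?_⟩
  have hle : F t₀ ≤ F T := hmono Set.self_mem_Ici hT hT
  calc ∫⁻ t in Set.Ioc 0 T, ENNReal.ofReal (u t)
      ≤ ENNReal.ofReal I + ENNReal.ofReal (F T - F t₀) := by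
        rw [← Set.Ioc_union_Ioc_eq_Ioc ht₀ hT, ENNReal.ofReal_toReal (hfin t₀)]
        exact (lintegral_union_le _ _ _).trans (add_le_add_right
          (setLIntegral_Ioc_le_sub_of_le_deriv hT hu (fun t ht => (h₀ t ht).1)
            fun t ht => (h₀ t ht).2.1) _)
    _ = ENNReal.ofReal (I + (F T - F t₀)) := (ENNReal.ofReal_add hI (sub_nonneg.2 hle)).symm
    _ ≤ ENNReal.ofReal ((I / F t₀ + 1) * F T) := by
        refine ENNReal.ofReal_le_ofReal ?_
        have : I ≤ I / F t₀ * F T := by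
          rw [div_mul_eq_mul_div, le_div_iff₀ hpos]
          gcongr
        linarith

end Comparison

section WeightIntegrals

/-- The function `t^(2p+1-x) exp(P t^x + Q t^y)`. If `y < x`, then `P x` times the weight is the
leading term of its derivative at infinity. -/
noncomputable def primitiveWeight (p P x Q y t : ℝ) : ℝ :=
  t ^ (2 * p + 1 - x) * Real.exp (P * t ^ x + Q * t ^ y)

/-- The quotient of the derivative of `primitiveWeight` by `t^(2p) exp(P t^x + Q t^y)`. -/
noncomputable def growthFactor (p P x Q y t : ℝ) : ℝ :=
  (2 * p + 1 - x) * t ^ (-x) + P * x + Q * y * t ^ (y - x)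

theorem primitiveWeight_pos (p P x Q y : ℝ) {t : ℝ} (ht : 0 < t) :
    0 < primitiveWeight p P x Q y t := by
  unfold primitiveWeight
  positivity

theorem primitiveWeight_zero (p t : ℝ) : primitiveWeight p 0 0 0 0 t = t ^ (2 * p + 1) := by
  simp [primitiveWeight]

theorem hasDerivAt_primitiveWeight (p P x Q y : ℝ) {t : ℝ} (ht : 0 < t) :
    HasDerivAt (primitiveWeight p P x Q y)
      (t ^ (2 * p) * Real.exp (P * t ^ x + Q * t ^ y) * growthFactor p P x Q y t) t := by
  have hpow := Real.hasDerivAt_rpow_const (p := 2 * p + 1 - x) (Or.inl ht.ne')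
  have hexponent := ((Real.hasDerivAt_rpow_const (p := x) (Or.inl ht.ne')).const_mul P).add
    ((Real.hasDerivAt_rpow_const (p := y) (Or.inl ht.ne')).const_mul Q)
  refine (hpow.mul hexponent.exp).congr_deriv ?_
  have e₁ : t ^ (2 * p + 1 - x - 1) = t ^ (2 * p) * t ^ (-x) := by
    rw [← Real.rpow_add ht]
    ring_nf
  have e₂ : t ^ (2 * p + 1 - x) * t ^ (x - 1) = t ^ (2 * p) := by
    rw [← Real.rpow_add ht]
    ring_nf
  have e₃ : t ^ (2 * p + 1 - x) * t ^ (y - 1) = t ^ (2 * p) * t ^ (y - x) := by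
    rw [← Real.rpow_add ht, ← Real.rpow_add ht]
    ring_nf
  simp only [growthFactor, e₁, Pi.add_apply]
  linear_combination (Real.exp (P * t ^ x + Q * t ^ y) * P * x) * e₂ +
    (Real.exp (P * t ^ x + Q * t ^ y) * Q * y) * e₃

theorem tendsto_growthFactor (p P Q : ℝ) {x y : ℝ} (hx : 0 < x) (hy : y < x) :
    Tendsto (growthFactor p P x Q y) atTop (𝓝 (P * x)) := by
  have hpow := (tendsto_rpow_neg_atTop hx).const_mul (2 * p + 1 - x)
  have hsub := (tendsto_rpow_neg_atTop (sub_pos.2 hy)).const_mul (Q * y)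
  have hsum := (hpow.add_const (P * x)).add hsub
  simp only [mul_zero, zero_add, add_zero, neg_sub] at hsum
  exact hsum

theorem tendsto_growthFactor_zero (p : ℝ) :
    Tendsto (growthFactor p 0 0 0 0) atTop (𝓝 (2 * p + 1)) :=
  tendsto_const_nhds.congr fun t => by simp [growthFactor]

theorem sq_add_one_rpow_le (p : ℝ) {t : ℝ} (ht : 1 ≤ t) :
    (t ^ 2 + 1) ^ p ≤ 2 ^ |p| * t ^ (2 * p) := by
  have hsq : t ^ (2 * p) = (t ^ 2) ^ p := by
    rw [Real.rpow_mul (by positivity), Real.rpow_two]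
  rw [hsq]
  rcases le_or_gt 0 p with hp | hp
  · rw [abs_of_nonneg hp, ← Real.mul_rpow (by norm_num) (by positivity)]
    exact Real.rpow_le_rpow (by positivity) (by nlinarith) hp
  · calc (t ^ 2 + 1) ^ p ≤ (t ^ 2) ^ p :=
          Real.rpow_le_rpow_of_nonpos (by positivity) (by linarith) hp.le
      _ ≤ 2 ^ |p| * (t ^ 2) ^ p :=
          le_mul_of_one_le_left (by positivity) (Real.one_le_rpow (by norm_num) (abs_nonneg _))

theorem eventually_weight_le_deriv {p P x Q y κ : ℝ} (hκ : κ ≠ 0)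
    (hgrowth : Tendsto (growthFactor p P x Q y) atTop (𝓝 κ)) :
    ∀ᶠ t in atTop, weight p P x Q y t ≤
      2 ^ |p| * (2 / κ) * deriv (primitiveWeight p P x Q y) t := by
  have hratio : Tendsto (fun t => 2 / κ * growthFactor p P x Q y t) atTop (𝓝 2) := by
    simpa only [div_mul_cancel₀ _ hκ] using hgrowth.const_mul (2 / κ)
  filter_upwards [hratio.eventually_const_le one_lt_two, eventually_ge_atTop 1] with t hle ht
  have ht₀ : 0 < t := by linarith
  rw [(hasDerivAt_primitiveWeight p P x Q y ht₀).deriv]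
  calc weight p P x Q y t
      ≤ 2 ^ |p| * t ^ (2 * p) * Real.exp (P * t ^ x + Q * t ^ y) := by
        unfold weight
        gcongr
        exact sq_add_one_rpow_le p ht
    _ ≤ 2 ^ |p| * t ^ (2 * p) * Real.exp (P * t ^ x + Q * t ^ y) *
          (2 / κ * growthFactor p P x Q y t) := le_mul_of_one_le_right (by positivity) hle
    _ = _ := by ring

theorem setLIntegral_Ioc_weight_ne_top (p P Q : ℝ) {x y : ℝ} (hx : 0 ≤ x) (hy : 0 ≤ y) (T : ℝ) :
    ∫⁻ t in Set.Ioc 0 T, ENNReal.ofReal (weight p P x Q y t) ≠ ∞ := by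
  have hcont : Continuous (weight p P x Q y) := by
    have hpow (e : ℝ) (he : 0 ≤ e) : Continuous fun t : ℝ => t ^ e := Real.continuous_rpow_const he
    have hbase : Continuous fun t : ℝ => (t ^ 2 + 1) ^ p :=
      Continuous.rpow_const (by fun_prop) fun t => Or.inl (by positivity)
    exact hbase.mul (((hpow x hx).const_mul P).add ((hpow y hy).const_mul Q)).rexp
  exact (hcont.integrableOn_Ioc (μ := volume)).lintegral_lt_top.ne

theorem exists_eventually_setLIntegral_Ioc_weight_le {p P x Q y κ : ℝ} (hx : 0 ≤ x) (hy : 0 ≤ y)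
    (hκ : 0 < κ) (hgrowth : Tendsto (growthFactor p P x Q y) atTop (𝓝 κ)) :
    ∃ C : ℝ, ∀ᶠ T in atTop, ∫⁻ t in Set.Ioc 0 T, ENNReal.ofReal (weight p P x Q y t) ≤
      ENNReal.ofReal (C * primitiveWeight p P x Q y T) := by
  have hdiff : ∀ᶠ t in atTop, DifferentiableAt ℝ (primitiveWeight p P x Q y) t :=
    (eventually_gt_atTop 0).mono fun t ht =>
      (hasDerivAt_primitiveWeight p P x Q y ht).differentiableAt
  obtain ⟨C, hC⟩ := exists_eventually_setLIntegral_Ioc_le_of_le_deriv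
    (F := fun t => 2 ^ |p| * (2 / κ) * primitiveWeight p P x Q y t) (weight_nonneg p P x Q y)
    (setLIntegral_Ioc_weight_ne_top p P Q hx hy) (hdiff.mono fun t ht => ht.const_mul _)
    ((hdiff.and (eventually_weight_le_deriv hκ.ne' hgrowth)).mono fun t ht => by
      simpa only [deriv_const_mul _ ht.1] using ht.2)
    ((eventually_gt_atTop 0).mono fun t ht => by
      have := primitiveWeight_pos p P x Q y ht
      positivity)
  exact ⟨C * (2 ^ |p| * (2 / κ)), by simpa only [mul_assoc] using hC⟩

theorem exists_eventually_setLIntegral_Ioi_weight_le {p P x Q y κ : ℝ} (hκ : κ < 0)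
    (hgrowth : Tendsto (growthFactor p P x Q y) atTop (𝓝 κ)) :
    ∃ C : ℝ, ∀ᶠ T in atTop, ∫⁻ t in Set.Ioi T, ENNReal.ofReal (weight p P x Q y t) ≤
      ENNReal.ofReal (C * primitiveWeight p P x Q y T) := by
  have hdiff : ∀ᶠ t in atTop, DifferentiableAt ℝ (primitiveWeight p P x Q y) t :=
    (eventually_gt_atTop 0).mono fun t ht =>
      (hasDerivAt_primitiveWeight p P x Q y ht).differentiableAt
  refine ⟨-(2 ^ |p| * (2 / κ)), eventually_setLIntegral_Ioi_le_of_le_neg_deriv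
    (weight_nonneg p P x Q y) (hdiff.mono fun t ht => ht.const_mul _)
    ((hdiff.and (eventually_weight_le_deriv hκ.ne hgrowth)).mono fun t ht => ?_)
    ((eventually_gt_atTop 0).mono fun t ht => ?_)⟩
  · rw [deriv_const_mul _ ht.1, neg_mul, neg_neg]
    exact ht.2
  · have hpos := primitiveWeight_pos p P x Q y ht
    have hcoeff : 2 ^ |p| * (2 / κ) ≤ 0 :=
      mul_nonpos_of_nonneg_of_nonpos (by positivity)
        (div_nonpos_of_nonneg_of_nonpos zero_le_two hκ.le)
    exact mul_nonneg (neg_nonneg.2 hcoeff) hpos.le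

theorem setLIntegral_Ioi_weight_ne_top {p P x Q y κ : ℝ} (hx : 0 ≤ x) (hy : 0 ≤ y) (hκ : κ < 0)
    (hgrowth : Tendsto (growthFactor p P x Q y) atTop (𝓝 κ)) :
    ∫⁻ t in Set.Ioi 0, ENNReal.ofReal (weight p P x Q y t) ≠ ∞ := by
  obtain ⟨C, hC⟩ := exists_eventually_setLIntegral_Ioi_weight_le hκ hgrowth
  obtain ⟨T, hT, hT₀⟩ := (hC.and (eventually_ge_atTop 0)).exists
  rw [← Set.Ioc_union_Ioi_eq_Ioi hT₀]
  exact ((lintegral_union_le _ _ _).trans_lt (ENNReal.add_lt_top.2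
    ⟨(setLIntegral_Ioc_weight_ne_top p P Q hx hy T).lt_top, hT.trans_lt ENNReal.ofReal_lt_top⟩)).ne

theorem exists_eventually_setLIntegral_Ioc_weight_le_log :
    ∃ C : ℝ, ∀ᶠ T in atTop, ∫⁻ t in Set.Ioc 0 T, ENNReal.ofReal (weight (-1 / 2) 0 0 0 0 t) ≤
      ENNReal.ofReal (C * Real.log T) := by
  refine exists_eventually_setLIntegral_Ioc_le_of_le_deriv (weight_nonneg _ _ _ _ _)
    (setLIntegral_Ioc_weight_ne_top _ _ _ le_rfl le_rfl)
    ((eventually_gt_atTop 0).mono fun t ht => Real.differentiableAt_log ht.ne')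
    ((eventually_gt_atTop 0).mono fun t ht => ?_)
    (Real.tendsto_log_atTop.eventually_gt_atTop 0)
  have hinv : t⁻¹ = (t ^ 2) ^ (-1 / 2 : ℝ) := by
    rw [← Real.rpow_natCast, ← Real.rpow_mul ht.le, ← Real.rpow_neg_one]
    norm_num
  rw [Real.deriv_log, hinv]
  simp only [weight, zero_mul, add_zero, Real.exp_zero, mul_one]
  exact Real.rpow_le_rpow_of_nonpos (by positivity) (by linarith) (by norm_num)

theorem weight_comm (p P x Q y : ℝ) : weight p P x Q y = weight p Q y P x := by
  ext t
  simp only [weight, add_comm]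

theorem weight_same_exponent (p P Q x : ℝ) : weight p P x Q x = weight p (P + Q) x 0 0 := by
  ext t
  simp only [weight]
  ring_nf

theorem weight_zero_coeff (p x y : ℝ) : weight p 0 x 0 y = weight p 0 0 0 0 := by
  ext t
  simp only [weight, zero_mul]

end WeightIntegrals

section Rates

open Asymptotics

/-- The variance of the cut-off estimators with bandwidths `h n` is of order `Δ n`, expressed
through a bound for `varianceIntegral`. -/
def IsVarianceRate (A₂ b d β γ : ℝ) (h Δ : ℕ → ℝ) : Prop :=
  ∃ v : ℕ → ℝ, (∀ᶠ n in atTop, varianceIntegral A₂ b d β γ (h n) ≤ ENNReal.ofReal (v n)) ∧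
    v =O[atTop] fun n => (n : ℝ) * Δ n

/-- The squared bias of the cut-off estimators with bandwidths `h n` is of order `Δ n`, expressed
through a bound for `biasIntegral`. Bounds that are at least `1` hold for free, because the bias
is bounded uniformly over the class. -/
def IsBiasRate (σ b d : ℝ) (h Δ : ℕ → ℝ) : Prop :=
  ∃ v : ℕ → ℝ, (∀ᶠ n in atTop, biasIntegral σ b d (h n) ≤ ENNReal.ofReal (v n) ∨ 1 ≤ v n) ∧
    v =O[atTop] Δ

variable {σ A₁ A₂ b d β γ θ : ℝ} {X Δ : ℕ → ℝ}

theorem isVarianceRate_zero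
    (hfin : ∫⁻ t in Set.Ioi 0, ENNReal.ofReal (weight A₂ (2 * γ) β (-2 * d) b t) ≠ ∞) :
    IsVarianceRate A₂ b d β γ (fun _ => 0) fun n => (n : ℝ)⁻¹ := by
  have hzero : varianceIntegral A₂ b d β γ 0 =
      ∫⁻ t in Set.Ioi 0, ENNReal.ofReal (weight A₂ (2 * γ) β (-2 * d) b t) := by
    simp [varianceIntegral]
  refine ⟨fun _ => (varianceIntegral A₂ b d β γ 0).toReal, .of_forall fun n => ?_, ?_⟩
  · rw [ENNReal.ofReal_toReal (hzero ▸ hfin)]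
  · refine (isBigO_const_const _ one_ne_zero atTop).trans_eventuallyEq ?_
    filter_upwards [eventually_ne_atTop 0] with n hn
    rw [mul_inv_cancel₀ (Nat.cast_ne_zero.2 hn)]

theorem isBiasRate_zero (σ b d : ℝ) (Δ : ℕ → ℝ) : IsBiasRate σ b d (fun _ => 0) Δ := by
  refine ⟨fun _ => 0, .of_forall fun n => Or.inl ?_, isBigO_zero _ _⟩
  have hset : {t : ℝ | 1 < 0 * t} = ∅ := by simp [not_lt.2 zero_le_one]
  rw [biasIntegral, hset, Set.inter_empty, setLIntegral_empty]
  exact zero_le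

theorem isBiasRate_of_one_isBigO (σ b d : ℝ) (h : ℕ → ℝ) (hΔ : (fun _ => (1 : ℝ)) =O[atTop] Δ) :
    IsBiasRate σ b d h Δ :=
  ⟨fun _ => 1, .of_forall fun _ => Or.inr le_rfl, hΔ⟩

theorem varianceIntegral_inv (A₂ b d β γ : ℝ) {T : ℝ} (hT : 0 < T) :
    varianceIntegral A₂ b d β γ T⁻¹ =
      ∫⁻ t in Set.Ioc 0 T, ENNReal.ofReal (weight A₂ (2 * γ) β (-2 * d) b t) := by
  have hset : Set.Ioi 0 ∩ {t : ℝ | T⁻¹ * t ≤ 1} = Set.Ioc 0 T := by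
    ext t
    rw [Set.mem_inter_iff, Set.mem_ofPred_eq, inv_mul_le_one₀ hT, Set.mem_Ioi, Set.mem_Ioc]
  rw [varianceIntegral, hset]

theorem biasIntegral_inv (σ b d : ℝ) {T : ℝ} (hT : 0 < T) :
    biasIntegral σ b d T⁻¹ =
      ∫⁻ t in Set.Ioi T, ENNReal.ofReal (weight (-σ) (-2 * d) b 0 0 t) := by
  have hset : Set.Ioi 0 ∩ {t : ℝ | 1 < T⁻¹ * t} = Set.Ioi T := by
    ext t
    rw [Set.mem_inter_iff, Set.mem_ofPred_eq, one_lt_inv_mul₀ hT, Set.mem_Ioi, Set.mem_Ioi]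
    exact and_iff_right_of_imp hT.trans
  rw [biasIntegral, hset]

theorem eventually_rpow_eq_inv (hX : Tendsto X atTop atTop) (θ : ℝ) :
    ∀ᶠ n in atTop, 0 < X n ^ (1 / θ) ∧ X n ^ (-1 / θ) = (X n ^ (1 / θ))⁻¹ := by
  filter_upwards [hX.eventually_gt_atTop 0] with n hn
  exact ⟨by positivity, by rw [← Real.rpow_neg hn.le, neg_div]⟩

theorem isVarianceRate_rpow (hX : Tendsto X atTop atTop) (hθ : 0 < θ) {F : ℝ → ℝ}
    (hF : ∃ C : ℝ, ∀ᶠ T in atTop, ∫⁻ t in Set.Ioc 0 T,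
      ENNReal.ofReal (weight A₂ (2 * γ) β (-2 * d) b t) ≤ ENNReal.ofReal (C * F T))
    (hΔ : (fun n => F (X n ^ (1 / θ))) =O[atTop] fun n => (n : ℝ) * Δ n) :
    IsVarianceRate A₂ b d β γ (fun n => X n ^ (-1 / θ)) Δ := by
  obtain ⟨C, hC⟩ := hF
  have hT : Tendsto (fun n => X n ^ (1 / θ)) atTop atTop :=
    (tendsto_rpow_atTop (by positivity)).comp hX
  refine ⟨fun n => C * F (X n ^ (1 / θ)), ?_, hΔ.const_mul_left C⟩
  filter_upwards [eventually_rpow_eq_inv hX θ, hT.eventually hC] with n hn hle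
  rwa [hn.2, varianceIntegral_inv _ _ _ _ _ hn.1]

theorem isBiasRate_rpow (hX : Tendsto X atTop atTop) (hθ : 0 < θ) {F : ℝ → ℝ}
    (hF : ∃ C : ℝ, ∀ᶠ T in atTop, ∫⁻ t in Set.Ioi T,
      ENNReal.ofReal (weight (-σ) (-2 * d) b 0 0 t) ≤ ENNReal.ofReal (C * F T))
    (hΔ : (fun n => F (X n ^ (1 / θ))) =O[atTop] Δ) :
    IsBiasRate σ b d (fun n => X n ^ (-1 / θ)) Δ := by
  obtain ⟨C, hC⟩ := hF
  have hT : Tendsto (fun n => X n ^ (1 / θ)) atTop atTop :=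
    (tendsto_rpow_atTop (by positivity)).comp hX
  refine ⟨fun n => C * F (X n ^ (1 / θ)), ?_, hΔ.const_mul_left C⟩
  filter_upwards [eventually_rpow_eq_inv hX θ, hT.eventually hC] with n hn hle
  rw [hn.2, biasIntegral_inv _ _ _ hn.1]
  exact Or.inl hle

theorem primitiveWeight_rpow (p P x Q y θ : ℝ) {r : ℝ} (hr : 0 ≤ r) :
    primitiveWeight p P x Q y (r ^ (1 / θ)) =
      r ^ ((2 * p + 1 - x) / θ) * Real.exp (P * r ^ (x / θ) + Q * r ^ (y / θ)) := by
  simp only [primitiveWeight, ← Real.rpow_mul hr, one_div_mul_eq_div]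

theorem isBiasRate_rpow_of_pos (hX : Tendsto X atTop atTop) (hθ : 0 < θ) (hb : 0 < b) (hd : 0 < d)
    (hΔ : (fun n => X n ^ (-(2 * (σ + (b - 1) / 2)) / θ) * Real.exp (-2 * d * X n ^ (b / θ)))
      =O[atTop] Δ) :
    IsBiasRate σ b d (fun n => X n ^ (-1 / θ)) Δ := by
  refine isBiasRate_rpow hX hθ (exists_eventually_setLIntegral_Ioi_weight_le (by nlinarith)
    (tendsto_growthFactor (-σ) (-2 * d) 0 hb hb)) (EventuallyEq.trans_isBigO ?_ hΔ)
  filter_upwards [hX.eventually_ge_atTop 0] with n hn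
  rw [primitiveWeight_rpow _ _ _ _ _ _ hn, zero_mul, add_zero]
  ring_nf

theorem isBiasRate_rpow_of_zero (hX : Tendsto X atTop atTop) (hθ : 0 < θ) (hσ : 1 / 2 < σ)
    (hΔ : (fun n => X n ^ (-(2 * (σ + (0 - 1) / 2)) / θ)) =O[atTop] Δ) :
    IsBiasRate σ 0 0 (fun n => X n ^ (-1 / θ)) Δ := by
  refine isBiasRate_rpow hX hθ (F := fun t => t ^ (2 * -σ + 1)) ?_
    (EventuallyEq.trans_isBigO ?_ hΔ)
  · simpa only [mul_zero, primitiveWeight_zero] using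
      exists_eventually_setLIntegral_Ioi_weight_le (by linarith) (tendsto_growthFactor_zero (-σ))
  · filter_upwards [hX.eventually_ge_atTop 0] with n hn
    rw [← Real.rpow_mul hn]
    ring_nf

theorem weight_cancel (p γ β : ℝ) : weight p (2 * γ) β (-2 * γ) β = weight p 0 0 0 0 := by
  rw [weight_same_exponent, show 2 * γ + -2 * γ = 0 by ring, weight_zero_coeff]

theorem isVarianceRate_rpow_of_eq_neg_half (hX : Tendsto X atTop atTop) (hθ : 0 < θ)
    (hΔ : (fun n => Real.log (X n)) =O[atTop] fun n => (n : ℝ) * Δ n) :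
    IsVarianceRate (-1 / 2) β γ β γ (fun n => X n ^ (-1 / θ)) Δ := by
  have hF := exists_eventually_setLIntegral_Ioc_weight_le_log
  rw [← weight_cancel _ γ β] at hF
  refine isVarianceRate_rpow hX hθ hF (EventuallyEq.trans_isBigO ?_ (hΔ.const_mul_left (1 / θ)))
  filter_upwards [hX.eventually_gt_atTop 0] with n hn using Real.log_rpow hn _

theorem isVarianceRate_rpow_of_neg_half_lt (hX : Tendsto X atTop atTop) (hθ : 0 < θ)
    (hA₂ : -1 / 2 < A₂)
    (hΔ : (fun n => X n ^ ((2 * A₂ + 1) / θ)) =O[atTop] fun n => (n : ℝ) * Δ n) :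
    IsVarianceRate A₂ β γ β γ (fun n => X n ^ (-1 / θ)) Δ := by
  have hF := exists_eventually_setLIntegral_Ioc_weight_le le_rfl le_rfl (by linarith)
    (tendsto_growthFactor_zero A₂)
  rw [← weight_cancel _ γ β] at hF
  refine isVarianceRate_rpow hX hθ hF (EventuallyEq.trans_isBigO ?_ hΔ)
  filter_upwards [hX.eventually_ge_atTop 0] with n hn
  rw [primitiveWeight_zero, ← Real.rpow_mul hn, one_div_mul_eq_div]

end Rates

section Logarithms

open Asymptotics

variable {A₁ A₂ β γ : ℝ}

theorem tendsto_log_natCast : Tendsto (fun n : ℕ => Real.log n) atTop atTop :=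
  Real.tendsto_log_atTop.comp tendsto_natCast_atTop_atTop

theorem tendsto_log_log_natCast : Tendsto (fun n : ℕ => Real.log (Real.log n)) atTop atTop :=
  Real.tendsto_log_atTop.comp tendsto_log_natCast

theorem isBigO_rpow_rpow {ι : Type*} {l : Filter ι} {L : ι → ℝ} (hL : Tendsto L l atTop) {p q : ℝ}
    (hpq : p ≤ q) : (fun i => L i ^ p) =O[l] fun i => L i ^ q := by
  refine IsBigO.of_bound' ?_
  filter_upwards [hL.eventually_ge_atTop 1] with i hi
  have : 0 ≤ L i := zero_le_one.trans hi
  rw [Real.norm_of_nonneg (by positivity), Real.norm_of_nonneg (by positivity)]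
  exact Real.rpow_le_rpow_of_exponent_le hi hpq

theorem isBigO_natCast_mul_inv_mul (F : ℕ → ℝ) :
    F =O[atTop] fun n : ℕ => (n : ℝ) * ((n : ℝ)⁻¹ * F n) := by
  refine (isBigO_refl F atTop).trans_eventuallyEq ?_
  filter_upwards [eventually_ne_atTop 0] with n hn
  rw [mul_inv_cancel_left₀ (Nat.cast_ne_zero.2 hn)]

theorem isTheta_log_div (hγ : 0 < γ) :
    (fun n : ℕ => Real.log n / (2 * γ)) =Θ[atTop] fun n : ℕ => Real.log n := by
  simp only [div_eq_mul_inv, mul_comm (Real.log _)]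
  exact (isTheta_refl _ _).const_mul_left (by positivity)

theorem isBigO_log_log_div (hγ : 0 < γ) :
    (fun n : ℕ => Real.log (Real.log n / (2 * γ))) =O[atTop]
      fun n : ℕ => Real.log (Real.log n) := by
  have hconst : (fun _ : ℕ => Real.log (2 * γ)) =O[atTop] fun n => Real.log (Real.log n) :=
    ((isLittleO_const_id_atTop _).comp_tendsto tendsto_log_log_natCast).isBigO
  refine EventuallyEq.trans_isBigO ?_ ((isBigO_refl _ _).sub hconst)
  filter_upwards [tendsto_log_natCast.eventually_ne_atTop 0] with n hn
  exact Real.log_div hn (by positivity)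

/-- The `β`-th power of the cut-off frequency `1 / hStar`. -/
noncomputable def cutoffLevel (A₁ A₂ β γ : ℝ) (n : ℕ) : ℝ :=
  1 / (2 * γ) * (Real.log n - (2 * A₁ + 2 * A₂ + 1 - β) / β * Real.log (Real.log n))

theorem isEquivalent_cutoffLevel (A₁ A₂ β γ : ℝ) :
    cutoffLevel A₁ A₂ β γ ~[atTop] fun n : ℕ => 1 / (2 * γ) * Real.log n := by
  have hloglog : (fun n : ℕ => (2 * A₁ + 2 * A₂ + 1 - β) / β * Real.log (Real.log n))
      =o[atTop] fun n : ℕ => Real.log n :=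
    (Real.isLittleO_log_id_atTop.comp_tendsto tendsto_log_natCast).const_mul_left _
  exact IsEquivalent.refl.mul (IsEquivalent.refl.sub_isLittleO hloglog)

theorem tendsto_cutoffLevel (A₁ A₂ β : ℝ) (hγ : 0 < γ) :
    Tendsto (cutoffLevel A₁ A₂ β γ) atTop atTop :=
  (isEquivalent_cutoffLevel A₁ A₂ β γ).symm.tendsto_atTop
    (tendsto_log_natCast.const_mul_atTop (by positivity))

theorem isTheta_cutoffLevel_rpow (A₁ A₂ β p : ℝ) (hγ : 0 < γ) :
    (fun n => cutoffLevel A₁ A₂ β γ n ^ p) =Θ[atTop] fun n : ℕ => Real.log n ^ p :=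
  IsTheta.rpow ((tendsto_cutoffLevel A₁ A₂ β hγ).eventually_ge_atTop 0)
    (tendsto_log_natCast.eventually_ge_atTop 0)
    ((isEquivalent_cutoffLevel A₁ A₂ β γ).isTheta.trans
      ((isTheta_refl _ _).const_mul_left (by positivity)))

theorem hStar_rpow_neg (A₁ A₂ β b : ℝ) (hγ : 0 < γ) : ∀ᶠ n in atTop,
    hStar A₁ A₂ β γ n ^ (-b) = cutoffLevel A₁ A₂ β γ n ^ (b / β) := by
  filter_upwards [(tendsto_cutoffLevel A₁ A₂ β hγ).eventually_ge_atTop 0] with n hn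
  calc (cutoffLevel A₁ A₂ β γ n ^ (-1 / β)) ^ (-b)
      = cutoffLevel A₁ A₂ β γ n ^ (-1 / β * -b) := (Real.rpow_mul hn _ _).symm
    _ = cutoffLevel A₁ A₂ β γ n ^ (b / β) := by ring_nf

theorem exp_mul_cutoffLevel (A₁ A₂ β κ : ℝ) (hγ : 0 < γ) : ∀ᶠ n : ℕ in atTop,
    Real.exp (κ * (2 * γ) * cutoffLevel A₁ A₂ β γ n) =
      (n : ℝ) ^ κ * Real.log n ^ (-κ * ((2 * A₁ + 2 * A₂ + 1 - β) / β)) := by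
  filter_upwards [tendsto_log_natCast.eventually_gt_atTop 0,
    tendsto_natCast_atTop_atTop.eventually_gt_atTop (0 : ℝ)] with n hlog hn
  rw [Real.rpow_def_of_pos hn, Real.rpow_def_of_pos hlog, ← Real.exp_add, cutoffLevel]
  congr 1
  field_simp
  ring

theorem hStar_rate_eq (A₁ A₂ d : ℝ) (hβ : 0 < β) (hγ : 0 < γ) :
    (fun n : ℕ => Real.log n ^ (-(2 * A₁) / β) * Real.exp (-2 * d * hStar A₁ A₂ β γ n ^ (-β)))
      =ᶠ[atTop] fun n => Real.log n ^ (-V₁ A₁ A₂ d β γ) * (n : ℝ) ^ (-d / γ) := by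
  filter_upwards [hStar_rpow_neg A₁ A₂ β β hγ, exp_mul_cutoffLevel A₁ A₂ β (-d / γ) hγ,
    tendsto_log_natCast.eventually_gt_atTop 0] with n hpow hexp hlog
  have hcoeff : -d / γ * (2 * γ) = -2 * d := by field_simp
  rw [hcoeff] at hexp
  rw [hpow, div_self hβ.ne', Real.rpow_one, hexp, mul_left_comm, ← Real.rpow_add hlog, mul_comm,
    V₁]
  congr 2
  field_simp
  ring

end Logarithms

section Regimes

open Asymptotics

variable {σ A₁ A₂ b d β γ : ℝ} {h Δ Δ' : ℕ → ℝ}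

theorem IsVarianceRate.congr (hv : IsVarianceRate A₂ b d β γ h Δ) (hΔ : Δ =ᶠ[atTop] Δ') :
    IsVarianceRate A₂ b d β γ h Δ' := by
  obtain ⟨v, hle, hO⟩ := hv
  exact ⟨v, hle, hO.trans_eventuallyEq (EventuallyEq.rfl.mul hΔ)⟩

theorem IsBiasRate.congr (hv : IsBiasRate σ b d h Δ) (hΔ : Δ =ᶠ[atTop] Δ') :
    IsBiasRate σ b d h Δ' := by
  obtain ⟨v, hle, hO⟩ := hv
  exact ⟨v, hle, hO.trans_eventuallyEq hΔ⟩

theorem isVarianceRate_zero_of_lt (A₂ γ : ℝ) (hβ : 0 ≤ β) (hb : β < b) (hd : 0 < d) :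
    IsVarianceRate A₂ b d β γ (fun _ => 0) fun n => (n : ℝ)⁻¹ := by
  refine isVarianceRate_zero ?_
  rw [weight_comm]
  exact setLIntegral_Ioi_weight_ne_top (hβ.trans hb.le) hβ (by nlinarith)
    (tendsto_growthFactor A₂ (-2 * d) (2 * γ) (hβ.trans_lt hb) hb)

theorem isVarianceRate_zero_of_coeff_lt (A₂ : ℝ) (hβ : 0 < β) (hd : γ < d) :
    IsVarianceRate A₂ β d β γ (fun _ => 0) fun n => (n : ℝ)⁻¹ := by
  refine isVarianceRate_zero ?_
  rw [weight_same_exponent]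
  exact setLIntegral_Ioi_weight_ne_top hβ.le le_rfl (by nlinarith)
    (tendsto_growthFactor A₂ (2 * γ + -2 * d) 0 hβ hβ)

theorem isVarianceRate_zero_of_lt_neg_half (β γ : ℝ) (hA₂ : A₂ < -1 / 2) :
    IsVarianceRate A₂ β γ β γ (fun _ => 0) fun n => (n : ℝ)⁻¹ := by
  refine isVarianceRate_zero ?_
  rw [weight_cancel]
  exact setLIntegral_Ioi_weight_ne_top le_rfl le_rfl (by linarith) (tendsto_growthFactor_zero A₂)

theorem isVarianceRate_log_div_of_eq_neg_half (hβ : 0 < β) (hγ : 0 < γ) :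
    IsVarianceRate (-1 / 2) β γ β γ (fun n => (Real.log n / (2 * γ)) ^ (-1 / β))
      fun n => (n : ℝ)⁻¹ * Real.log (Real.log n) :=
  isVarianceRate_rpow_of_eq_neg_half (tendsto_log_natCast.atTop_div_const (by positivity)) hβ
    ((isBigO_log_log_div hγ).trans (isBigO_natCast_mul_inv_mul _))

theorem isVarianceRate_log_div_of_neg_half_lt (hβ : 0 < β) (hγ : 0 < γ) (hA₂ : -1 / 2 < A₂) :
    IsVarianceRate A₂ β γ β γ (fun n => (Real.log n / (2 * γ)) ^ (-1 / β))
      fun n => (n : ℝ)⁻¹ * Real.log n ^ ((2 * A₂ + 1) / β) := by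
  have hX : Tendsto (fun n : ℕ => Real.log n / (2 * γ)) atTop atTop :=
    tendsto_log_natCast.atTop_div_const (by positivity)
  have hpow := (isTheta_log_div hγ).rpow (r := (2 * A₂ + 1) / β) (hX.eventually_ge_atTop 0)
    (tendsto_log_natCast.eventually_ge_atTop 0)
  exact isVarianceRate_rpow_of_neg_half_lt hX hβ hA₂
    (hpow.isBigO.trans (isBigO_natCast_mul_inv_mul _))

theorem isBiasRate_log_div (hβ : 0 < β) (hγ : 0 < γ) {F : ℕ → ℝ}
    (hF : (fun n : ℕ => Real.log n ^ (-(2 * (σ + (β - 1) / 2)) / β)) =O[atTop] F) :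
    IsBiasRate σ β γ (fun n => (Real.log n / (2 * γ)) ^ (-1 / β)) fun n => (n : ℝ)⁻¹ * F n := by
  have hX : Tendsto (fun n : ℕ => Real.log n / (2 * γ)) atTop atTop :=
    tendsto_log_natCast.atTop_div_const (by positivity)
  have hpow := (isTheta_log_div hγ).rpow (r := -(2 * (σ + (β - 1) / 2)) / β)
    (hX.eventually_ge_atTop 0) (tendsto_log_natCast.eventually_ge_atTop 0)
  refine isBiasRate_rpow_of_pos hX hβ hβ hγ (EventuallyEq.trans_isBigO ?_
    ((isBigO_refl (fun n : ℕ => (n : ℝ)⁻¹) atTop).mul (hpow.isBigO.trans hF)))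
  filter_upwards [tendsto_natCast_atTop_atTop.eventually_gt_atTop (0 : ℝ)] with n hn
  have hexp : Real.exp (-2 * γ * (Real.log n / (2 * γ))) = (n : ℝ)⁻¹ := by
    rw [show -2 * γ * (Real.log n / (2 * γ)) = -Real.log n by field_simp, Real.exp_neg,
      Real.exp_log hn]
  rw [div_self hβ.ne', Real.rpow_one, hexp, mul_comm]

theorem exists_eventually_setLIntegral_Ioc_varianceWeight_le (A₂ : ℝ) (hβ : 0 < β) (hγ : 0 < γ)
    (hb : 0 ≤ b) (hcase : b < β ∨ b = β ∧ d < γ) :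
    ∃ C : ℝ, ∀ᶠ T in atTop, ∫⁻ t in Set.Ioc 0 T,
      ENNReal.ofReal (weight A₂ (2 * γ) β (-2 * d) b t) ≤
        ENNReal.ofReal (C * primitiveWeight A₂ (2 * γ) β (-2 * d) b T) := by
  rcases hcase with hlt | ⟨rfl, hlt⟩
  · exact exists_eventually_setLIntegral_Ioc_weight_le hβ.le hb (by positivity)
      (tendsto_growthFactor A₂ (2 * γ) (-2 * d) hβ hlt)
  · have hprim : primitiveWeight A₂ (2 * γ) b (-2 * d) b =
        primitiveWeight A₂ (2 * γ + -2 * d) b 0 0 := by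
      ext T
      simp only [primitiveWeight]
      ring_nf
    rw [weight_same_exponent, hprim]
    exact exists_eventually_setLIntegral_Ioc_weight_le hβ.le le_rfl (by nlinarith)
      (tendsto_growthFactor A₂ (2 * γ + -2 * d) 0 hβ hβ)

theorem isVarianceRate_hStar (A₁ A₂ : ℝ) (hβ : 0 < β) (hγ : 0 < γ) (hb : 0 ≤ b)
    (hcase : b < β ∨ b = β ∧ d < γ) :
    IsVarianceRate A₂ b d β γ (hStar A₁ A₂ β γ) fun n =>
      Real.log n ^ (-(2 * A₁) / β) * Real.exp (-2 * d * hStar A₁ A₂ β γ n ^ (-b)) := by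
  have hX := tendsto_cutoffLevel A₁ A₂ β hγ
  have hpow := (isTheta_cutoffLevel_rpow A₁ A₂ β ((2 * A₂ + 1 - β) / β) hγ).isBigO
  have hrest := isBigO_refl (fun n : ℕ => Real.exp (2 * γ * cutoffLevel A₁ A₂ β γ n) *
    Real.exp (-2 * d * hStar A₁ A₂ β γ n ^ (-b))) atTop
  refine isVarianceRate_rpow (X := cutoffLevel A₁ A₂ β γ) hX hβ
    (exists_eventually_setLIntegral_Ioc_varianceWeight_le A₂ hβ hγ hb hcase)
    (EventuallyEq.trans_isBigO ?_ ((hpow.mul hrest).trans_eventuallyEq ?_))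
  · filter_upwards [hX.eventually_ge_atTop 0, hStar_rpow_neg A₁ A₂ β b hγ] with n hn hb
    rw [primitiveWeight_rpow _ _ _ _ _ _ hn, div_self hβ.ne', Real.rpow_one, ← hb, Real.exp_add]
  · filter_upwards [exp_mul_cutoffLevel A₁ A₂ β 1 hγ,
      tendsto_log_natCast.eventually_gt_atTop 0] with n hexp hlog
    rw [one_mul, Real.rpow_one] at hexp
    rw [hexp, mul_assoc, mul_left_comm, ← mul_assoc (Real.log _ ^ _), ← Real.rpow_add hlog]
    ring_nf

theorem isBiasRate_hStar_of_pos (σ A₂ : ℝ) (hβ : 0 < β) (hγ : 0 < γ) (hb : 0 < b) (hd : 0 < d) :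
    IsBiasRate σ b d (hStar (σ + (b - 1) / 2) A₂ β γ) fun n =>
      Real.log n ^ (-(2 * (σ + (b - 1) / 2)) / β) *
        Real.exp (-2 * d * hStar (σ + (b - 1) / 2) A₂ β γ n ^ (-b)) := by
  have hpow := (isTheta_cutoffLevel_rpow (σ + (b - 1) / 2) A₂ β
    (-(2 * (σ + (b - 1) / 2)) / β) hγ).isBigO
  refine isBiasRate_rpow_of_pos (X := cutoffLevel (σ + (b - 1) / 2) A₂ β γ)
    (tendsto_cutoffLevel _ A₂ β hγ) hβ hb hd ((hpow.mul (isBigO_refl _ _)).trans_eventuallyEq ?_)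
  filter_upwards [hStar_rpow_neg (σ + (b - 1) / 2) A₂ β b hγ] with n hn
  rw [hn]

theorem isBiasRate_hStar_of_zero (σ A₂ : ℝ) (hβ : 0 < β) (hγ : 0 < γ) :
    IsBiasRate σ 0 0 (hStar (σ + (0 - 1) / 2) A₂ β γ) fun n =>
      Real.log n ^ (-(2 * (σ + (0 - 1) / 2)) / β) := by
  rcases le_or_gt σ (1 / 2) with hσ | hσ
  · refine isBiasRate_of_one_isBigO _ _ _ _ ?_
    simpa only [Real.rpow_zero] using isBigO_rpow_rpow tendsto_log_natCast (p := 0)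
      (div_nonneg (by linarith) hβ.le)
  · exact isBiasRate_rpow_of_zero (tendsto_cutoffLevel _ A₂ β hγ) hβ hσ
      (isTheta_cutoffLevel_rpow _ _ _ _ hγ).isBigO

theorem isVarianceRate_natCast_rpow (hA₂ : -1 / 2 < A₂) (hD : 0 < 2 * A₁ + 2 * A₂ + 1) :
    IsVarianceRate A₂ 0 0 0 0 (fun n => (n : ℝ) ^ (-1 / (2 * A₁ + 2 * A₂ + 1)))
      fun n => (n : ℝ) ^ (-(2 * A₁) / (2 * A₁ + 2 * A₂ + 1)) := by
  refine isVarianceRate_rpow_of_neg_half_lt tendsto_natCast_atTop_atTop hD hA₂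
    ((isBigO_refl _ _).trans_eventuallyEq ?_)
  filter_upwards [tendsto_natCast_atTop_atTop.eventually_gt_atTop (0 : ℝ)] with n hn
  have hexp : (2 * A₂ + 1) / (2 * A₁ + 2 * A₂ + 1) =
      1 + -(2 * A₁) / (2 * A₁ + 2 * A₂ + 1) := by
    rw [eq_comm, ← eq_sub_iff_add_eq', div_sub_one hD.ne']
    ring
  rw [hexp, Real.rpow_add hn, Real.rpow_one]

theorem isBiasRate_natCast_rpow (hD : 0 < 2 * (σ + (0 - 1) / 2) + 2 * A₂ + 1) :
    IsBiasRate σ 0 0 (fun n => (n : ℝ) ^ (-1 / (2 * (σ + (0 - 1) / 2) + 2 * A₂ + 1)))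
      fun n => (n : ℝ) ^ (-(2 * (σ + (0 - 1) / 2)) / (2 * (σ + (0 - 1) / 2) + 2 * A₂ + 1)) := by
  rcases le_or_gt σ (1 / 2) with hσ | hσ
  · refine isBiasRate_of_one_isBigO _ _ _ _ ?_
    simpa only [Real.rpow_zero] using isBigO_rpow_rpow tendsto_natCast_atTop_atTop (p := 0)
      (div_nonneg (by linarith) hD.le)
  · exact isBiasRate_rpow_of_zero tendsto_natCast_atTop_atTop hD hσ (isBigO_refl _ _)

theorem isBiasRate_natCast_rpow_inv_two_mul (hσ : 0 < σ + (0 - 1) / 2) :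
    IsBiasRate σ 0 0 (fun n => (n : ℝ) ^ (-1 / (2 * (σ + (0 - 1) / 2))))
      fun n => (n : ℝ)⁻¹ * Real.log n := by
  have hone : (fun _ : ℕ => (1 : ℝ)) =O[atTop] fun n : ℕ => Real.log n :=
    ((isLittleO_const_id_atTop _).comp_tendsto tendsto_log_natCast).isBigO
  refine isBiasRate_rpow_of_zero tendsto_natCast_atTop_atTop (mul_pos two_pos hσ) (by linarith)
    (EventuallyEq.trans_isBigO (.of_forall fun n => ?_)
      ((isBigO_refl (fun n : ℕ => (n : ℝ)⁻¹) atTop).mul hone))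
  simp only [neg_div, div_self (mul_pos two_pos hσ).ne', Real.rpow_neg_one, mul_one]

theorem RateTable.isVarianceRate (hT : RateTable (σ + (b - 1) / 2) A₂ b d β γ h Δ) (hd : 0 ≤ d)
    (hβ : 0 ≤ β) (hσ : γ = 0 → 0 < σ + A₂) (hd₀ : d = 0 → b = 0) :
    IsVarianceRate A₂ b d β γ h Δ := by
  cases hT with
  | case1 hb =>
    have hd' : 0 < d := hd.lt_of_ne' fun h0 => (hβ.trans_lt hb).ne' (hd₀ h0)
    exact isVarianceRate_zero_of_lt A₂ γ hβ hb hd'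
  | case2 hb hβ' hdγ =>
    subst hb
    exact isVarianceRate_zero_of_coeff_lt A₂ hβ' hdγ
  | case3 hb hdγ hA =>
    subst hb hdγ
    exact isVarianceRate_zero_of_lt_neg_half b d hA
  | case4 hb hβ' hdγ hγ hA =>
    subst hb hdγ hA
    exact isVarianceRate_log_div_of_eq_neg_half hβ' hγ
  | case5 hb hβ' hdγ hγ hA =>
    subst hb hdγ
    exact isVarianceRate_log_div_of_neg_half_lt hβ' hγ hA
  | case6 hb hβ' hd' hγ hA =>
    subst hb hβ' hd' hγ hA
    exact isVarianceRate_rpow_of_eq_neg_half tendsto_natCast_atTop_atTop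
      (by linarith [hσ rfl]) (isBigO_natCast_mul_inv_mul _)
  | case7 hb hβ' hd' hγ hA =>
    subst hb hβ' hd' hγ
    exact isVarianceRate_natCast_rpow hA (by linarith [hσ rfl])
  | case8 hb hβ' hdγ hd' =>
    subst hb
    exact (isVarianceRate_hStar _ A₂ hβ' (hd'.trans hdγ) hβ (Or.inr ⟨rfl, hdγ⟩)).congr
      (hStar_rate_eq _ A₂ d hβ' (hd'.trans hdγ))
  | case9 hbβ hb hd' hγ =>
    exact isVarianceRate_hStar _ A₂ (hb.trans hbβ) hγ hb.le (Or.inl hbβ)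
  | case10 hb hd' hβ' hγ =>
    subst hb hd'
    simpa using isVarianceRate_hStar _ A₂ hβ' hγ le_rfl (Or.inl hβ') (d := 0)

theorem RateTable.isBiasRate (hT : RateTable (σ + (b - 1) / 2) A₂ b d β γ h Δ)
    (hσ : 0 ≤ σ + A₂) (hσ₀ : γ = 0 → 0 < σ + A₂) : IsBiasRate σ b d h Δ := by
  cases hT with
  | case1 | case2 | case3 => exact isBiasRate_zero σ b d _
  | case4 hb hβ hdγ hγ hA =>
    subst hb hdγ
    have hexp : -(2 * (σ + (b - 1) / 2)) / b ≤ 0 :=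
      div_nonpos_of_nonpos_of_nonneg (by linarith) hβ.le
    have hone : (fun _ : ℕ => (1 : ℝ)) =O[atTop] fun n : ℕ => Real.log (Real.log n) :=
      ((isLittleO_const_id_atTop _).comp_tendsto tendsto_log_log_natCast).isBigO
    refine isBiasRate_log_div hβ hγ (IsBigO.trans ?_ hone)
    simpa only [Real.rpow_zero] using isBigO_rpow_rpow tendsto_log_natCast hexp
  | case5 hb hβ hdγ hγ =>
    subst hb hdγ
    exact isBiasRate_log_div hβ hγ (isBigO_rpow_rpow tendsto_log_natCast
      (div_le_div_of_nonneg_right (by linarith) hβ.le))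
  | case6 hb hβ hd hγ hA =>
    subst hb hβ hd hγ hA
    exact isBiasRate_natCast_rpow_inv_two_mul (by linarith [hσ₀ rfl])
  | case7 hb hβ hd hγ =>
    subst hb hβ hd hγ
    exact isBiasRate_natCast_rpow (by linarith [hσ₀ rfl])
  | case8 hb hβ hdγ hd =>
    subst hb
    exact (isBiasRate_hStar_of_pos σ A₂ hβ (hd.trans hdγ) hβ hd).congr
      (hStar_rate_eq _ A₂ d hβ (hd.trans hdγ))
  | case9 hbβ hb hd hγ => exact isBiasRate_hStar_of_pos σ A₂ (hb.trans hbβ) hγ hb hd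
  | case10 hb hd hβ hγ =>
    subst hb hd
    exact isBiasRate_hStar_of_zero σ A₂ hβ hγ

theorem RateTable.eventually_nonneg (hT : RateTable A₁ A₂ b d β γ h Δ) :
    ∀ᶠ n in atTop, 0 ≤ Δ n := by
  cases hT with
  | case4 =>
    filter_upwards [tendsto_log_log_natCast.eventually_ge_atTop 0] with n hn
    positivity
  | _ => exact .of_forall fun n => by positivity

end Regimes

theorem exists_eventually_worstRisk_le {s B a b d α β γ Cg Cφ : ℝ} (hCg : 0 < Cg) {g : ℝ → ℝ}
    (hg : IsPdf g) (hg_bdd : BddAbove (Set.range g))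
    (hg_low : ∀ ω, envelope Cg α γ β ω ≤ ‖ft g ω‖) {φs : ℝ → ℂ} (hφ : Measurable φs)
    (hφ_up : ∀ ω, ‖φs ω‖ ≤ envelope Cφ a d b ω) {Φ : (ℝ → ℝ) → ℂ}
    (hΦ : IsRepresentedOn (sobolevBall s B) Φ φs) {h Δ : ℕ → ℝ}
    (hvar : IsVarianceRate (α - a) b d β γ h Δ) (hbias : IsBiasRate (s + a) b d h Δ)
    (hΔ : ∀ᶠ n in atTop, 0 ≤ Δ n) :
    ∃ C : ℝ, 0 < C ∧ ∀ᶠ n in atTop,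
      worstRisk (sobolevBall s B) g Φ φs n (h n) ≤ ENNReal.ofReal (C * Δ n) := by
  obtain ⟨K, hK, hrisk⟩ := exists_worstRisk_le hCg hg hg_bdd hg_low hφ hφ_up hΦ
  obtain ⟨v, hv, hvO⟩ := hvar
  obtain ⟨w, hw, hwO⟩ := hbias
  obtain ⟨C₁, hC₁, hvC⟩ := hvO.exists_pos
  obtain ⟨C₂, hC₂, hwC⟩ := hwO.exists_pos
  refine ⟨K * (C₁ + C₂), by positivity, ?_⟩
  filter_upwards [hv, hw, hvC.bound, hwC.bound, hΔ, eventually_ne_atTop 0]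
    with n hvn hwn hvn_le hwn_le hΔn hn
  rw [Real.norm_of_nonneg (mul_nonneg n.cast_nonneg hΔn)] at hvn_le
  rw [Real.norm_of_nonneg hΔn] at hwn_le
  refine (hrisk n (h n) ‖v n‖ ‖w n‖ hn (norm_nonneg _) (norm_nonneg _)
    (hvn.trans (ENNReal.ofReal_le_ofReal (Real.le_norm_self _)))
    (hwn.imp (fun hle => hle.trans (ENNReal.ofReal_le_ofReal (Real.le_norm_self _)))
      fun hle => hle.trans (Real.le_norm_self _))).trans (ENNReal.ofReal_le_ofReal ?_)
  calc K * ((n : ℝ)⁻¹ * ‖v n‖ + ‖w n‖)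
      ≤ K * ((n : ℝ)⁻¹ * (C₁ * (n * Δ n)) + C₂ * Δ n) := by gcongr
    _ = K * (C₁ + C₂) * Δ n := by field_simp

end Deconv

theorem theorem1_general
    (s B a b d α β γ Cg Cφ : ℝ)
    (hd : 0 ≤ d) (hβ : 0 ≤ β) (hCg : 0 < Cg)
    (hsα : 0 ≤ s + α) (hsα₀ : γ = 0 → 0 < s + α)
    (hd₀ : d = 0 → b = 0)
    (g : ℝ → ℝ) (hg : Deconv.IsPdf g) (hg_bdd : BddAbove (Set.range g))
    (hg_low : ∀ ω : ℝ,
      Cg * (ω ^ 2 + 1) ^ (-α / 2) * Real.exp (-γ * |ω| ^ β) ≤ ‖Deconv.ft g ω‖)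
    (φs : ℝ → ℂ) (hφ_meas : Measurable φs)
    (hφ_up : ∀ ω : ℝ,
      ‖φs ω‖ ≤ Cφ * (ω ^ 2 + 1) ^ (-a / 2) * Real.exp (-d * |ω| ^ b))
    (Φ : (ℝ → ℝ) → ℂ) (hΦ : Deconv.IsRepresentedOn (Deconv.sobolevBall s B) Φ φs)
    (h Δ : ℕ → ℝ)
    (hT : Deconv.RateTable (s + a + (b - 1) / 2) (α - a) b d β γ h Δ) :
    ∃ C : ℝ, 0 < C ∧ ∀ᶠ n : ℕ in Filter.atTop,
      Deconv.worstRisk (Deconv.sobolevBall s B) g Φ φs n (h n) ≤ ENNReal.ofReal (C * Δ n) := by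
  have hsum : s + a + (α - a) = s + α := by ring
  rw [← hsum] at hsα hsα₀
  exact Deconv.exists_eventually_worstRisk_le hCg hg hg_bdd hg_low hφ_meas hφ_up hΦ
    (hT.isVarianceRate hd hβ hsα₀ hd₀) (hT.isBiasRate hsα hsα₀) hT.eventually_nonneg

theorem theorem1
    (s B a b d α β γ Cg Cφ : ℝ)
    (hs : 0 ≤ s) (hB : 0 < B)
    (ha : 0 ≤ a) (hb : 0 ≤ b) (hd : 0 ≤ d)
    (hα : 0 ≤ α) (hβ : 0 ≤ β) (hγ : 0 ≤ γ)
    (hCg : 0 < Cg) (hCφ : 0 ≤ Cφ)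
    (hγ₀ : γ = 0 → 0 < α ∧ β = 0)
    (hd₀ : d = 0 → b = 0)
    (g : ℝ → ℝ) (hg : Deconv.IsPdf g) (hg_bdd : BddAbove (Set.range g))
    (hg_low : ∀ ω : ℝ,
      Cg * (ω ^ 2 + 1) ^ (-α / 2) * Real.exp (-γ * |ω| ^ β) ≤ ‖Deconv.ft g ω‖)
    (φs : ℝ → ℂ) (hφ_meas : Measurable φs)
    (hφ_up : ∀ ω : ℝ,
      ‖φs ω‖ ≤ Cφ * (ω ^ 2 + 1) ^ (-a / 2) * Real.exp (-d * |ω| ^ b))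
    (Φ : (ℝ → ℝ) → ℂ) (hΦ : Deconv.IsRepresentedOn (Deconv.sobolevBall s B) Φ φs)
    (h Δ : ℕ → ℝ)
    (hT : Deconv.RateTable (s + a + (b - 1) / 2) (α - a) b d β γ h Δ) :
    ∃ C : ℝ, 0 < C ∧ ∀ᶠ n : ℕ in Filter.atTop,
      Deconv.worstRisk (Deconv.sobolevBall s B) g Φ φs n (h n) ≤ ENNReal.ofReal (C * Δ n) :=
  theorem1_general s B a b d α β γ Cg Cφ hd hβ hCg (add_nonneg hs hα)
    (fun h0 => add_pos_of_nonneg_of_pos hs (hγ₀ h0).1) hd₀ g hg hg_bdd hg_low φs hφ_meas hφ_up Φ hΦ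
    h Δ hT
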